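/- Consider a downlink with $M$ access points (APs), each with $L$ antennas, $K$ single-antenna information users (IUs) and $J$ single-antenna energy users (EUs), where $L>K$, and a beyond-diagonal RIS with $N$ elements and a scattering matrix $\Theta$ satisfying $\Theta=\Theta^T$, $\Theta^H\Theta=I_N$. **Channels.** AP $m$ has the channel $g^I_{mk}\sim\mathcal{CN}(0,\beta_{mk}I_L)$ to IU $k$, with $\beta_{mk}>0$, and the channel $g^E_{mj}=h_{mj}+H_m^H\Theta z_j$ to EU $j$. Here $h_{mj}\sim\mathcal{CN}(0,\beta^E_{mj}I_L)$ with $\beta^E_{mj}>0$, $H_m\in\mathbb{C}^{N\times L}$ has independent columns with law $\mathcal{CN}(0,\Omega_m)$, and $z_j\sim\mathcal{CN}(0,\Psi_j)$, with $\Omega_m,\Psi_j$ positive semidefinite. All these vectors, over all $m,k,j$ and all columns, are mutually independent. **Training.** A coherence interval has $\tau_c$ symbols, of which $\tau\le\tau_c$ are used for training. The $K+J$ users send orthonormal pilots $\varphi_u\in\mathbb{C}^\tau$, and AP $m$ receives $Y_m=\sqrt{\tau\rho_u}\sum_u g_{mu}\varphi_u^H+N_m$, where $\rho_u>0$ and the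 entries of $N_m\in\mathbb{C}^{L\times\tau}$ are i.i.d. $\mathcal{CN}(0,1)$, independent over $m$ and of the channels. From $Y_m\varphi_u$, AP $m$ forms the minimum mean square error (MMSE) estimate $\hat g^I_{mk}$ of each IU channel, and the MMSE or linear MMSE estimate $\hat g^E_{mj}$ of each EU channel. Put $\gamma_{mk}=\tau\rho_u\beta_{mk}^2/(\tau\rho_u\beta_{mk}+1)$. **Precoding.** Let $\hat G_m=[\hat g^I_{m1},\dots,\hat g^I_{mK}]$, let $e_k$ be the $k$-th standard basis vector of $\mathbb{C}^K$, and let $B_m=I_L-\hat G_m(\hat G_m^H\hat G_m)^{-1}\hat G_m^H$. The precoders (partial zero-forcing towards the IUs, protective maximum ratio transmission towards the EUs) are $$w^I_{mk}=\alpha^I_{mk}\,\hat G_m(\hat G_m^H\hat G_m)^{-1}e_k,\qquad w^E_{mj}=\alpha^E_{mj}\,B_m\hat g^E_{mj},$$ where each $\alpha>0$ is the inverse square root of the expected squared norm of the vector it multiplies. Let $a_m\in\{0,1\}$ indicate whether AP $m$ is an information AP ($a_m=1$) or an energy AP ($a_m=0$), let $\eta^I_{mk},\eta^E_{mj}\ge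 0$ be power control coefficients, and let $\rho_d>0$ be the downlink SNR. **Spectral efficiency.** The ergodic spectral efficiency (SE) of IU $k$ is the one of the hardening bound, $$\mathrm{SE}_k=\Big(1-\frac{\tau}{\tau_c}\Big)\log_2(1+\mathrm{SINR}_k),$$ $$\mathrm{SINR}_k=\frac{|\mathrm{DS}_k|^2}{\mathbb E|\mathrm{BU}_k|^2+\sum_{k'\ne k}\mathbb E|\mathrm{IUI}_{kk'}|^2+\sum_j\mathbb E|\mathrm{EUI}_{kj}|^2+1},$$ where $$\mathrm{DS}_k=\sum_m\sqrt{a_m\rho_d\eta^I_{mk}}\;\mathbb E\{(g^I_{mk})^Hw^I_{mk}\},$$ $$\mathrm{BU}_k=\sum_m\sqrt{a_m\rho_d\eta^I_{mk}}\,\big((g^I_{mk})^Hw^I_{mk}-\mathbb E\{(g^I_{mk})^Hw^I_{mk}\}\big),$$ $$\mathrm{IUI}_{kk'}=\sum_m\sqrt{a_m\rho_d\eta^I_{mk'}}\,(g^I_{mk})^Hw^I_{mk'},\qquad \mathrm{EUI}_{kj}=\sum_m\sqrt{(1-a_m)\rho_d\eta^E_{mj}}\,(g^I_{mk})^Hw^E_{mj}.$$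 **Proposition.** Each entry of $\hat g^I_{mk}$ has second moment $\gamma_{mk}$, each $\hat G_m^H\hat G_m$ is almost surely invertible, all precoders satisfy $\mathbb E\|w^I_{mk}\|^2=\mathbb E\|w^E_{mj}\|^2=1$, all expectations above are finite, and for every IU $k$ $$\mathrm{SINR}_k=\frac{(L-K)\Big(\sum_{m}\sqrt{a_m\eta^I_{mk}\gamma_{mk}}\Big)^2}{\sum_{k'}\sum_m a_m\eta^I_{mk'}(\beta_{mk}-\gamma_{mk})+\sum_{j}\sum_m(1-a_m)\eta^E_{mj}(\beta_{mk}-\gamma_{mk})+1/\rho_d},$$ so that the ergodic SE of IU $k$ is $(1-\tau/\tau_c)\log_2(1+\mathrm{SINR}_k)$ with this value of $\mathrm{SINR}_k$. -/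

import Mathlib

open MeasureTheory ProbabilityTheory
open scoped Matrix ComplexOrder

namespace CellFree

/-- Complex column vectors of length `n`, with the Euclidean norm. -/
abbrev CVec (n : ℕ) := EuclideanSpace ℂ (Fin n)

/-- `X` is a circularly symmetric complex Gaussian vector, `X ∼ CN(0, C)`, expressed through the
characteristic function `E exp(i Re(tᴴ X)) = exp(-tᴴ C t / 4)`. -/
def IsCN {Ω : Type*} [MeasurableSpace Ω] (μ : Measure Ω) {n : ℕ} (X : Ω → CVec n)
    (C : Matrix (Fin n) (Fin n) ℂ) : Prop :=
  Measurable X ∧ ∀ t : CVec n,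
    ∫ ω, Complex.exp (Complex.I * ((inner ℂ t (X ω)).re : ℂ)) ∂μ
      = Complex.exp (-(((star (t.ofLp) ⬝ᵥ (C *ᵥ t.ofLp)).re : ℂ) / 4))

/-- The deterministic data of the network: `M` APs with `L` antennas, `K` information users,
`J` energy users, a BD-RIS with `N` elements, pilots of length `τ`. -/
structure Network (M K J L N τ : ℕ) where
  /-- large-scale fading, AP to information user -/
  betaI : Fin M → Fin K → ℝ
  /-- large-scale fading, direct link from AP to energy user -/
  betaE : Fin M → Fin J → ℝ
  /-- covariance of each column of the channel from an AP to the BD-RIS -/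
  covAP : Fin M → Matrix (Fin N) (Fin N) ℂ
  /-- covariance of the channel from the BD-RIS to an energy user -/
  covEU : Fin J → Matrix (Fin N) (Fin N) ℂ
  /-- scattering matrix of the BD-RIS -/
  Theta : Matrix (Fin N) (Fin N) ℂ
  /-- pilot sequences of the information users and of the energy users -/
  pilot : Fin K ⊕ Fin J → CVec τ
  /-- uplink training SNR -/
  rhoU : ℝ
  /-- downlink SNR -/
  rhoD : ℝ
  betaI_pos : ∀ m k, 0 < betaI m k
  betaE_pos : ∀ m j, 0 < betaE m j
  covAP_psd : ∀ m, (covAP m).PosSemidef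
  covEU_psd : ∀ j, (covEU j).PosSemidef
  Theta_symm : Thetaᵀ = Theta
  Theta_unitary : Thetaᴴ * Theta = 1
  pilot_orthonormal : Orthonormal ℂ pilot
  rhoU_pos : 0 < rhoU
  rhoD_pos : 0 < rhoD

/-- Labels of the independent sources of randomness. -/
inductive Source (M K J L τ : ℕ) : Type
  /-- channel from AP `m` to information user `k` -/
  | iu (m : Fin M) (k : Fin K)
  /-- direct channel from AP `m` to energy user `j` -/
  | eu (m : Fin M) (j : Fin J)
  /-- channel from antenna `l` of AP `m` to the BD-RIS -/
  | ap (m : Fin M) (l : Fin L)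
  /-- channel from the BD-RIS to energy user `j` -/
  | ris (j : Fin J)
  /-- noise at AP `m` in training symbol `t` -/
  | noise (m : Fin M) (t : Fin τ)

/-- The dimension of the random vector carried by a source. -/
def Source.dim {M K J L τ : ℕ} (N : ℕ) : Source M K J L τ → ℕ
  | .iu _ _ => L
  | .eu _ _ => L
  | .ap _ _ => N
  | .ris _ => N
  | .noise _ _ => L

/-- The covariance matrix of each source. -/
def Network.cov {M K J L N τ : ℕ} (P : Network M K J L N τ) :
    (s : Source M K J L τ) → Matrix (Fin (s.dim N)) (Fin (s.dim N)) ℂ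
  | .iu m k => ((P.betaI m k : ℝ) : ℂ) • (1 : Matrix (Fin L) (Fin L) ℂ)
  | .eu m j => ((P.betaE m j : ℝ) : ℂ) • (1 : Matrix (Fin L) (Fin L) ℂ)
  | .ap m _ => P.covAP m
  | .ris j => P.covEU j
  | .noise _ _ => (1 : Matrix (Fin L) (Fin L) ℂ)

/-- The random vectors of one coherence interval, one for each source. -/
abbrev Fading (M K J L N τ : ℕ) (Ω : Type*) :=
  (s : Source M K J L τ) → Ω → CVec (s.dim N)

section Model

variable {M K J L N τ : ℕ} {Ω : Type*} [MeasurableSpace Ω]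

/-- Independent Rayleigh fading and independent white training noise: all sources are mutually
independent, circularly symmetric complex Gaussian with the prescribed covariances. -/
def Network.IsRayleigh (P : Network M K J L N τ) (μ : Measure Ω)
    (X : Fading M K J L N τ Ω) : Prop :=
  (∀ s, IsCN μ (X s) (P.cov s)) ∧ iIndepFun X μ

/-- Channel between AP `m` and information user `k`. -/
def chanI (X : Fading M K J L N τ Ω) (m : Fin M) (k : Fin K) (ω : Ω) : CVec L :=
  X (.iu m k) ω

/-- The channel matrix `H_m` from AP `m` to the BD-RIS; its `l`-th column is the channel of
antenna `l`. -/
def risMatrix (X : Fading M K J L N τ Ω) (m : Fin M) (ω : Ω) : Matrix (Fin N) (Fin L) ℂ :=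
  Matrix.of fun n l => (show CVec N from X (.ap m l) ω) n

/-- Aggregated channel between AP `m` and energy user `j`: direct link plus the cascaded link
`H_mᴴ Θ z_j` through the BD-RIS. -/
def Network.chanE (P : Network M K J L N τ) (X : Fading M K J L N τ Ω)
    (m : Fin M) (j : Fin J) (ω : Ω) : CVec L :=
  (show CVec L from X (.eu m j) ω) +
    WithLp.toLp 2 ((risMatrix X m ω)ᴴ *ᵥ
      (P.Theta *ᵥ (show CVec N from X (.ris j) ω).ofLp))

/-- Channel between AP `m` and any user. -/
def Network.chan (P : Network M K J L N τ) (X : Fading M K J L N τ Ω)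
    (m : Fin M) (u : Fin K ⊕ Fin J) (ω : Ω) : CVec L :=
  Sum.elim (fun k => chanI X m k ω) (fun j => P.chanE X m j ω) u

/-- Training signal received at AP `m`: `√(τ ρ_u) ∑_u g_{mu} φ_uᴴ + noise`. -/
noncomputable def Network.received (P : Network M K J L N τ) (X : Fading M K J L N τ Ω)
    (m : Fin M) (ω : Ω) : Matrix (Fin L) (Fin τ) ℂ :=
  Matrix.of fun l t =>
    ((Real.sqrt (τ * P.rhoU) : ℝ) : ℂ) *
        ∑ u : Fin K ⊕ Fin J, P.chan X m u ω l * star (P.pilot u t)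
      + (show CVec L from X (.noise m t) ω) l

/-- Projection of the received training signal onto the pilot of user `u`. -/
noncomputable def Network.observation (P : Network M K J L N τ) (X : Fading M K J L N τ Ω)
    (m : Fin M) (u : Fin K ⊕ Fin J) (ω : Ω) : CVec L :=
  WithLp.toLp 2 (P.received X m ω *ᵥ (P.pilot u).ofLp)

/-- `gHat` is an estimate of `g` from the observation `y` which minimises the mean square error
among all square integrable estimates `f(y)` with `f` measurable and in the class `F`. -/
def IsOptimalEstimate (μ : Measure Ω) (F : Set (CVec L → CVec L)) (g y gHat : Ω → CVec L) :
    Prop :=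
  ∃ f ∈ F, Measurable f ∧ MemLp (fun ω => f (y ω)) 2 μ ∧ (∀ ω, gHat ω = f (y ω)) ∧
    ∀ f' ∈ F, Measurable f' → MemLp (fun ω => f' (y ω)) 2 μ →
      ∫ ω, ‖g ω - f (y ω)‖ ^ 2 ∂μ ≤ ∫ ω, ‖g ω - f' (y ω)‖ ^ 2 ∂μ

/-- Minimum mean square error (MMSE) estimate. -/
def IsMMSE (μ : Measure Ω) (g y gHat : Ω → CVec L) : Prop :=
  IsOptimalEstimate μ Set.univ g y gHat

/-- Linear MMSE estimate. -/
def IsLinearMMSE (μ : Measure Ω) (g y gHat : Ω → CVec L) : Prop :=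
  IsOptimalEstimate μ (Set.range fun A : CVec L →ₗ[ℂ] CVec L => (A : CVec L → CVec L)) g y gHat

/-- Variance of each entry of the estimated channel of an information user,
`γ = τ ρ_u β² / (τ ρ_u β + 1)`. -/
noncomputable def Network.gammaI (P : Network M K J L N τ) (m : Fin M) (k : Fin K) : ℝ :=
  τ * P.rhoU * P.betaI m k ^ 2 / (τ * P.rhoU * P.betaI m k + 1)

/-- The matrix whose columns are the given estimated channels. -/
def colMatrix {U : ℕ} (v : Fin U → Ω → CVec L) (ω : Ω) : Matrix (Fin L) (Fin U) ℂ :=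
  Matrix.of fun l u => v u ω l

/-- Unnormalised zero-forcing direction `G (Gᴴ G)⁻¹ e_k`. -/
noncomputable def zfDir (gI : Fin K → Ω → CVec L) (k : Fin K) (ω : Ω) : CVec L :=
  let G := colMatrix gI ω
  WithLp.toLp 2 ((G * (Gᴴ * G)⁻¹) *ᵥ Pi.single k 1)

/-- Projection matrix `1 - G (Gᴴ G)⁻¹ Gᴴ` onto the orthogonal complement of the estimated channels
of the information users. -/
noncomputable def nullProj (gI : Fin K → Ω → CVec L) (ω : Ω) : Matrix (Fin L) (Fin L) ℂ :=
  let G := colMatrix gI ω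
  1 - G * (Gᴴ * G)⁻¹ * Gᴴ

/-- Unnormalised protective maximum-ratio direction `B Gᴱ e_j`. -/
noncomputable def pmrtDir (gI : Fin K → Ω → CVec L) (gE : Fin J → Ω → CVec L) (j : Fin J)
    (ω : Ω) : CVec L :=
  WithLp.toLp 2 ((nullProj gI ω * colMatrix gE ω) *ᵥ Pi.single j 1)

/-- The normalisation `(E ‖v‖²)^(-1/2)`. -/
noncomputable def normFactor (μ : Measure Ω) (v : Ω → CVec L) : ℝ :=
  (∫ ω, ‖v ω‖ ^ 2 ∂μ) ^ (-(1 / 2) : ℝ)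

/-- Partial zero-forcing precoder of an AP towards information user `k`. -/
noncomputable def precoderI (μ : Measure Ω) (gI : Fin K → Ω → CVec L) (k : Fin K) (ω : Ω) :
    CVec L :=
  ((normFactor μ (zfDir gI k) : ℝ) : ℂ) • zfDir gI k ω

/-- Protective maximum-ratio precoder of an AP towards energy user `j`. -/
noncomputable def precoderE (μ : Measure Ω) (gI : Fin K → Ω → CVec L) (gE : Fin J → Ω → CVec L)
    (j : Fin J) (ω : Ω) : CVec L :=
  ((normFactor μ (pmrtDir gI gE j) : ℝ) : ℂ) • pmrtDir gI gE j ω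

/-- A downlink configuration: operation modes (`1` for an information AP, `0` for an energy AP)
and power control coefficients. -/
structure Control (M K J : ℕ) where
  a : Fin M → ℝ
  etaI : Fin M → Fin K → ℝ
  etaE : Fin M → Fin J → ℝ
  a_mode : ∀ m, a m = 0 ∨ a m = 1
  etaI_nonneg : ∀ m k, 0 ≤ etaI m k
  etaE_nonneg : ∀ m j, 0 ≤ etaE m j

/-- Effective gain `(g_{mk})ᴴ w` at information user `k` of the signal sent by AP `m` with the
precoder `w`. -/
noncomputable def gain (X : Fading M K J L N τ Ω) (m : Fin M) (k : Fin K) (w : Ω → CVec L)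
    (ω : Ω) : ℂ :=
  inner ℂ (chanI X m k ω) (w ω)

/-- Desired signal. -/
noncomputable def Network.DS (P : Network M K J L N τ) (Q : Control M K J) (μ : Measure Ω)
    (X : Fading M K J L N τ Ω) (gI : Fin M → Fin K → Ω → CVec L) (k : Fin K) : ℂ :=
  ∑ m, ((Real.sqrt (Q.a m * P.rhoD * Q.etaI m k) : ℝ) : ℂ) *
    ∫ ω, gain X m k (precoderI μ (gI m) k) ω ∂μ

/-- Beamforming gain uncertainty. -/
noncomputable def Network.BU (P : Network M K J L N τ) (Q : Control M K J) (μ : Measure Ω)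
    (X : Fading M K J L N τ Ω) (gI : Fin M → Fin K → Ω → CVec L) (k : Fin K) (ω : Ω) : ℂ :=
  ∑ m, ((Real.sqrt (Q.a m * P.rhoD * Q.etaI m k) : ℝ) : ℂ) *
    (gain X m k (precoderI μ (gI m) k) ω - ∫ ω', gain X m k (precoderI μ (gI m) k) ω' ∂μ)

/-- Interference at information user `k` caused by information user `k'`. -/
noncomputable def Network.IUI (P : Network M K J L N τ) (Q : Control M K J) (μ : Measure Ω)
    (X : Fading M K J L N τ Ω) (gI : Fin M → Fin K → Ω → CVec L) (k k' : Fin K) (ω : Ω) : ℂ :=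
  ∑ m, ((Real.sqrt (Q.a m * P.rhoD * Q.etaI m k') : ℝ) : ℂ) *
    gain X m k (precoderI μ (gI m) k') ω

/-- Interference at information user `k` caused by energy user `j`. -/
noncomputable def Network.EUI (P : Network M K J L N τ) (Q : Control M K J) (μ : Measure Ω)
    (X : Fading M K J L N τ Ω) (gI : Fin M → Fin K → Ω → CVec L)
    (gE : Fin M → Fin J → Ω → CVec L) (k : Fin K) (j : Fin J) (ω : Ω) : ℂ :=
  ∑ m, ((Real.sqrt ((1 - Q.a m) * P.rhoD * Q.etaE m j) : ℝ) : ℂ) *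
    gain X m k (precoderE μ (gI m) (gE m) j) ω

/-- Effective SINR of information user `k` in the hardening bound. -/
noncomputable def Network.SINR (P : Network M K J L N τ) (Q : Control M K J) (μ : Measure Ω)
    (X : Fading M K J L N τ Ω) (gI : Fin M → Fin K → Ω → CVec L)
    (gE : Fin M → Fin J → Ω → CVec L) (k : Fin K) : ℝ :=
  ‖P.DS Q μ X gI k‖ ^ 2 /
    (∫ ω, ‖P.BU Q μ X gI k ω‖ ^ 2 ∂μ
      + ∑ k' ∈ Finset.univ.erase k, ∫ ω, ‖P.IUI Q μ X gI k k' ω‖ ^ 2 ∂μ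
      + ∑ j, ∫ ω, ‖P.EUI Q μ X gI gE k j ω‖ ^ 2 ∂μ
      + 1)

/-- Ergodic spectral efficiency (bit/s/Hz) of information user `k` by the hardening bound, for
coherence intervals of `τc` symbols. -/
noncomputable def Network.SE (P : Network M K J L N τ) (Q : Control M K J) (τc : ℕ)
    (μ : Measure Ω) (X : Fading M K J L N τ Ω) (gI : Fin M → Fin K → Ω → CVec L)
    (gE : Fin M → Fin J → Ω → CVec L) (k : Fin K) : ℝ :=
  (1 - (τ : ℝ) / τc) * Real.logb 2 (1 + P.SINR Q μ X gI gE k)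

/-- The closed-form SINR of information user `k`. -/
noncomputable def Network.closedSINR (P : Network M K J L N τ) (Q : Control M K J) (k : Fin K) :
    ℝ :=
  ((L : ℝ) - K) * (∑ m, Real.sqrt (Q.a m * Q.etaI m k * P.gammaI m k)) ^ 2 /
    (∑ k', ∑ m, Q.a m * Q.etaI m k' * (P.betaI m k - P.gammaI m k)
      + ∑ j, ∑ m, (1 - Q.a m) * Q.etaE m j * (P.betaI m k - P.gammaI m k)
      + 1 / P.rhoD)

end Model

end CellFree

/-!
The proof rests on the split of the channel of an information user into its estimate and an
estimation error. For a white Gaussian channel observed in white noise the error left by the linear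
estimate is uncorrelated with the observation, hence, by joint Gaussianity, independent of it; so
the linear estimate is the only MMSE estimate, up to null sets (`IsMMSE.ae_eq`). The errors and the
observations for the information users and the projected noise for the energy users, at all APs, are
linear images of independent white vectors with orthogonal coefficient rows
(`Network.trainCoef_orthogonal`), so they are mutually independent (`linear_images_white`), and they
are independent of the sources that make up the channels of the energy users. Thus the error of an
AP for an information user is independent of all precoders and of the errors of the other APs
(`Network.IsRayleigh.indepFun_error`).

With the estimate in place of the channel, the gain of a zero-forcing precoder is deterministic and
vanishes at all other information users, and that of a protective precoder vanishes at all of them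
(`inner_zfDir`, `inner_pmrtDir`). All the interference therefore comes from the errors. Its variance adds up over
the APs, because the law of an error is symmetric and the cross terms are odd in it
(`memLp_integral_norm_sum_inner_sq`), and each AP contributes the error variance `β - γ` times the
unit power of the precoder.

The factor `L - K` is the array gain of zero-forcing: the squared norm of a zero-forcing direction
is the inverse of the squared norm of the projection of a white vector on the orthogonal complement
of `K - 1` independent others (`norm_zfDir_sq`), which has dimension `L - K + 1` almost surely. That
squared norm has the Laplace transform `(1 + s c)^{-(L - K + 1)}`, and integrating it over `s`
yields the inverse moment `1 / (c (L - K))` (`IsWhite.lintegral_inv_sum_inner_sq`).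

For the energy users, only the existence of the normalisation is at stake. Their estimates do not
vanish almost surely, since a small multiple of an observation correlated with the channel beats the
zero estimate (`IsOptimalEstimate.not_ae_eq_zero`), and, being independent of the `K < L` estimates
of the information users, they almost surely do not lie in the span of these unless they vanish
(`ae_linearIndependent_snoc_of_indepFun`).
-/

namespace CellFree

/-! ### White and complex normal vectors -/

section Gaussian

variable {Ω : Type*} [MeasurableSpace Ω] {μ : Measure Ω} {n : ℕ}

/-- The real inner product in Mathlib's characteristic functions is the one in the definition of
`IsCN`. -/
lemma real_inner_eq_re_inner (x y : CVec n) : inner ℝ x y = (inner ℂ x y).re := by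
  simp only [PiLp.inner_apply, Complex.re_sum, Complex.inner]
  exact Finset.sum_congr rfl fun i _ => by simp [mul_comm]

/-- White vectors: `X ∼ CN(0, c I)`. The degenerate case `c = 0` is allowed. -/
abbrev IsWhite (μ : Measure Ω) (X : Ω → CVec n) (c : ℝ) : Prop :=
  IsCN μ X ((c : ℂ) • (1 : Matrix (Fin n) (Fin n) ℂ))

lemma re_star_dotProduct_smul_one (c : ℝ) (t : CVec n) :
    (star t.ofLp ⬝ᵥ (((c : ℂ) • (1 : Matrix (Fin n) (Fin n) ℂ)) *ᵥ t.ofLp)).re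
      = c * ‖t‖ ^ 2 := by
  rw [Matrix.smul_mulVec, Matrix.one_mulVec, dotProduct_smul, EuclideanSpace.norm_sq_eq]
  simp only [dotProduct, Pi.star_apply, smul_eq_mul, Complex.re_ofReal_mul, Complex.re_sum]
  congr 1
  refine Finset.sum_congr rfl fun i _ => ?_
  simp [Complex.sq_norm, Complex.normSq_apply]

lemma isWhite_iff {X : Ω → CVec n} {c : ℝ} :
    IsWhite μ X c ↔ Measurable X ∧ ∀ t : CVec n,
      ∫ ω, Complex.exp (Complex.I * ((inner ℂ t (X ω)).re : ℂ)) ∂μ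
        = Complex.exp ((-(c * ‖t‖ ^ 2 / 4) : ℝ)) := by
  unfold IsWhite IsCN
  simp only [re_star_dotProduct_smul_one]
  push_cast
  rfl

lemma charFun_map {X : Ω → CVec n} (hX : Measurable X) (t : CVec n) :
    charFun (μ.map X) t
      = ∫ ω, Complex.exp (Complex.I * ((inner ℂ t (X ω)).re : ℂ)) ∂μ := by
  rw [charFun_apply, integral_map hX.aemeasurable (by fun_prop)]
  refine integral_congr_ae (.of_forall fun ω => ?_)
  simp only [real_inner_comm t, real_inner_eq_re_inner, mul_comm]

/-- Two vectors with the same complex normal distribution have the same law. -/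
lemma IsCN.map_eq [IsProbabilityMeasure μ] {X Y : Ω → CVec n} {C : Matrix (Fin n) (Fin n) ℂ}
    (hX : IsCN μ X C) (hY : IsCN μ Y C) : μ.map X = μ.map Y := by
  have := Measure.isProbabilityMeasure_map (μ := μ) hX.1.aemeasurable
  have := Measure.isProbabilityMeasure_map (μ := μ) hY.1.aemeasurable
  refine Measure.ext_of_charFun (funext fun t => ?_)
  rw [charFun_map hX.1, charFun_map hY.1, hX.2, hY.2]

lemma IsCN.map_id {X : Ω → CVec n} {C : Matrix (Fin n) (Fin n) ℂ} (hX : IsCN μ X C) :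
    IsCN (μ.map X) id C := by
  refine ⟨measurable_id, fun t => ?_⟩
  rw [integral_map hX.1.aemeasurable (by fun_prop)]
  exact hX.2 t

lemma IsCN.neg {X : Ω → CVec n} {C : Matrix (Fin n) (Fin n) ℂ} (hX : IsCN μ X C) :
    IsCN μ (fun ω => -X ω) C := by
  refine ⟨hX.1.neg, fun t => ?_⟩
  have := hX.2 (-t)
  simpa [Matrix.mulVec_neg] using this

lemma IsCN.congr {X Y : Ω → CVec n} {C : Matrix (Fin n) (Fin n) ℂ} (hX : IsCN μ X C)
    (hY : Measurable Y) (h : X =ᵐ[μ] Y) : IsCN μ Y C := by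
  refine ⟨hY, fun t => ?_⟩
  rw [← hX.2 t]
  exact integral_congr_ae (by filter_upwards [h] with ω hω; rw [hω])

/-- The real projections of a complex normal vector are real Gaussian variables. -/
lemma IsCN.map_re_inner [IsProbabilityMeasure μ] {X : Ω → CVec n}
    {C : Matrix (Fin n) (Fin n) ℂ} (hX : IsCN μ X C) (hC : C.PosSemidef) (t : CVec n) :
    μ.map (fun ω => (inner ℂ t (X ω)).re)
      = gaussianReal 0 ((star t.ofLp ⬝ᵥ (C *ᵥ t.ofLp)).re / 2).toNNReal := by
  have hm : Measurable (fun ω => (inner ℂ t (X ω)).re) := by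
    have := hX.1; fun_prop
  have := Measure.isProbabilityMeasure_map (μ := μ) hm.aemeasurable
  refine Measure.ext_of_charFun (funext fun s => ?_)
  have h0 : 0 ≤ (star t.ofLp ⬝ᵥ (C *ᵥ t.ofLp)).re :=
    (Complex.nonneg_iff.mp (hC.dotProduct_mulVec_nonneg t.ofLp)).1
  rw [charFun_gaussianReal, charFun_apply_real, integral_map hm.aemeasurable (by fun_prop)]
  have := hX.2 ((s : ℂ) • t)
  have e1 : (star ((s : ℂ) • t).ofLp ⬝ᵥ (C *ᵥ ((s : ℂ) • t).ofLp)).re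
      = s ^ 2 * (star t.ofLp ⬝ᵥ (C *ᵥ t.ofLp)).re := by
    simp only [WithLp.ofLp_smul, star_smul, Matrix.mulVec_smul, dotProduct_smul, smul_dotProduct,
      smul_eq_mul, Complex.star_def, Complex.conj_ofReal, Complex.re_ofReal_mul]
    ring
  rw [e1] at this
  rw [Real.coe_toNNReal _ (by positivity)]
  convert this using 3 with ω
  · simp only [inner_smul_left, Complex.conj_ofReal, Complex.re_ofReal_mul]
    push_cast; ring_nf
  · push_cast; ring

lemma IsCN.memLp_re_inner [IsProbabilityMeasure μ] {X : Ω → CVec n}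
    {C : Matrix (Fin n) (Fin n) ℂ} (hX : IsCN μ X C) (hC : C.PosSemidef) (t : CVec n) :
    MemLp (fun ω => (inner ℂ t (X ω)).re) 2 μ := by
  have hm : Measurable (fun ω => (inner ℂ t (X ω)).re) := by
    have := hX.1; fun_prop
  have h := memLp_id_gaussianReal (μ := 0)
    (v := ((star t.ofLp ⬝ᵥ (C *ᵥ t.ofLp)).re / 2).toNNReal) 2
  rw [← hX.map_re_inner hC t] at h
  exact_mod_cast (memLp_map_measure_iff (by fun_prop) hm.aemeasurable).mp h

lemma IsCN.integral_re_inner_sq [IsProbabilityMeasure μ] {X : Ω → CVec n}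
    {C : Matrix (Fin n) (Fin n) ℂ} (hX : IsCN μ X C) (hC : C.PosSemidef) (t : CVec n) :
    ∫ ω, (inner ℂ t (X ω)).re ^ 2 ∂μ = (star t.ofLp ⬝ᵥ (C *ᵥ t.ofLp)).re / 2 := by
  have hm : Measurable (fun ω => (inner ℂ t (X ω)).re) := by
    have := hX.1; fun_prop
  have h0 : 0 ≤ (star t.ofLp ⬝ᵥ (C *ᵥ t.ofLp)).re :=
    (Complex.nonneg_iff.mp (hC.dotProduct_mulVec_nonneg t.ofLp)).1
  have h := variance_id_gaussianReal (μ := 0)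
    (v := ((star t.ofLp ⬝ᵥ (C *ᵥ t.ofLp)).re / 2).toNNReal)
  rw [variance_of_integral_eq_zero (by fun_prop) (by simp), ← hX.map_re_inner hC t,
    integral_map hm.aemeasurable (by fun_prop), Real.coe_toNNReal _ (by positivity)] at h
  exact h

lemma re_inner_I_smul (t x : CVec n) :
    (inner ℂ ((Complex.I) • t) x).re = (inner ℂ t x).im := by
  simp

/-- The complex projections of a complex normal vector are square integrable. -/
lemma IsCN.memLp_inner [IsProbabilityMeasure μ] {X : Ω → CVec n}
    {C : Matrix (Fin n) (Fin n) ℂ} (hX : IsCN μ X C) (hC : C.PosSemidef) (t : CVec n) :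
    MemLp (fun ω => inner ℂ t (X ω)) 2 μ := by
  refine memLp_re_im_iff.mp ⟨hX.memLp_re_inner hC t, ?_⟩
  have h := hX.memLp_re_inner hC (Complex.I • t)
  simp only [re_inner_I_smul] at h
  exact h

lemma IsCN.memLp [IsProbabilityMeasure μ] {X : Ω → CVec n}
    {C : Matrix (Fin n) (Fin n) ℂ} (hX : IsCN μ X C) (hC : C.PosSemidef) : MemLp X 2 μ := by
  refine MemLp.of_eval_piLp fun l => ?_
  simpa [EuclideanSpace.inner_single_left] using hX.memLp_inner hC (EuclideanSpace.single l 1)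

lemma posSemidef_smul_one {c : ℝ} (hc : 0 ≤ c) :
    ((c : ℂ) • (1 : Matrix (Fin n) (Fin n) ℂ)).PosSemidef :=
  Matrix.PosSemidef.one.smul (by exact_mod_cast hc)

lemma IsWhite.memLp [IsProbabilityMeasure μ] {X : Ω → CVec n} {c : ℝ} (hc : 0 ≤ c)
    (hX : IsWhite μ X c) : MemLp X 2 μ := IsCN.memLp hX (posSemidef_smul_one hc)

lemma IsWhite.integral_norm_inner_sq [IsProbabilityMeasure μ] {X : Ω → CVec n} {c : ℝ}
    (hc : 0 ≤ c) (hX : IsWhite μ X c) (t : CVec n) :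
    ∫ ω, ‖(inner ℂ t (X ω) : ℂ)‖ ^ 2 ∂μ = c * ‖t‖ ^ 2 := by
  have hp := posSemidef_smul_one (n := n) hc
  have h1 := IsCN.integral_re_inner_sq hX hp t
  have h2 := IsCN.integral_re_inner_sq hX hp (Complex.I • t)
  have i1 := (IsCN.memLp_re_inner hX hp t).integrable_sq
  have i2 := (IsCN.memLp_re_inner hX hp (Complex.I • t)).integrable_sq
  rw [re_star_dotProduct_smul_one] at h1 h2
  simp only [re_inner_I_smul] at h2 i2
  simp only [Complex.sq_norm, Complex.normSq_apply, ← pow_two]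
  rw [integral_add i1 i2, h1, h2, norm_smul]
  simp

end Gaussian

/-! ### Independence and symmetry of white vectors -/

section Independence

variable {Ω : Type*} [MeasurableSpace Ω] {μ : Measure Ω} [IsProbabilityMeasure μ] {n : ℕ}

omit [IsProbabilityMeasure μ] in
/-- The joint characteristic function of linear images of independent white vectors whose
coefficient rows are orthogonal with respect to the variances. -/
lemma integral_exp_linear_images {S ι : Type*} [Fintype S] [Fintype ι] [DecidableEq ι]
    {V : S → Ω → CVec n} (hV : iIndepFun V μ) {σ : S → ℝ} (hσ : ∀ s, IsWhite μ (V s) (σ s))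
    {a : ι → S → ℂ} {c : ι → ℝ}
    (ha : ∀ i i', ∑ s, (σ s : ℂ) * (a i s * star (a i' s)) = if i = i' then (c i : ℂ) else 0)
    (t : ι → CVec n) :
    ∫ ω, Complex.exp (Complex.I * ((∑ i, inner ℂ (t i) (∑ s, a i s • V s ω)).re : ℂ)) ∂μ
      = ∏ i, Complex.exp ((-(c i * ‖t i‖ ^ 2 / 4) : ℝ)) := by
  set u : S → CVec n := fun s => ∑ i, star (a i s) • t i with hu
  have h1 : ∀ ω, ∑ i, inner ℂ (t i) (∑ s, a i s • V s ω) = ∑ s, inner ℂ (u s) (V s ω) := by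
    intro ω
    simp only [hu, sum_inner, inner_sum, inner_smul_left, inner_smul_right, Complex.star_def,
      Complex.conj_conj]
    exact Finset.sum_comm
  have h2 : ∀ ω, Complex.exp (Complex.I * ((∑ i, inner ℂ (t i) (∑ s, a i s • V s ω)).re : ℂ))
      = ∏ s, Complex.exp (Complex.I * ((inner ℂ (u s) (V s ω)).re : ℂ)) := by
    intro ω
    rw [h1, ← Complex.exp_sum, ← Finset.mul_sum, Complex.re_sum, Complex.ofReal_sum]
  have hmeas : ∀ s, Measurable (V s) := fun s => (hσ s).1
  have hind := hV.comp (fun s x => Complex.exp (Complex.I * ((inner ℂ (u s) x).re : ℂ)))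
    (fun s => by fun_prop)
  simp only [h2]
  have h3 := hind.integral_fun_prod_eq_prod_integral
    (fun s => (Measurable.aestronglyMeasurable (by have := hmeas s; fun_prop)))
  simp only [Function.comp_apply] at h3
  rw [h3]
  simp only [fun s => (isWhite_iff.mp (hσ s)).2 (u s)]
  rw [← Complex.exp_sum, ← Complex.exp_sum]
  congr 1
  rw [← Complex.ofReal_sum, ← Complex.ofReal_sum]
  congr 1
  have h4 : ∑ s, σ s * ‖u s‖ ^ 2 = ∑ i, c i * ‖t i‖ ^ 2 := by
    apply Complex.ofReal_injective
    push_cast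
    have h5 : ∀ x : CVec n, ((‖x‖ : ℝ) : ℂ) ^ 2 = inner ℂ x x := fun x =>
      (inner_self_eq_norm_sq_to_K x).symm
    simp only [h5, hu, sum_inner, inner_sum, inner_smul_left, inner_smul_right]
    have h6 : ∀ i, (c i : ℂ) * inner ℂ (t i) (t i)
        = ∑ i', (∑ s, (σ s : ℂ) * (a i' s * star (a i s))) * inner ℂ (t i') (t i) := by
      intro i
      simp only [ha, ite_mul, zero_mul, Finset.sum_ite_eq', Finset.mem_univ, if_true]
    simp only [h6, Finset.sum_mul, Finset.mul_sum]
    rw [Finset.sum_comm]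
    refine Finset.sum_congr rfl fun i _ => ?_
    rw [Finset.sum_comm]
    refine Finset.sum_congr rfl fun i' _ => ?_
    refine Finset.sum_congr rfl fun s _ => ?_
    simp only [Complex.star_def, Complex.conj_conj]
    ring
  simp only [Finset.sum_neg_distrib, ← Finset.sum_div, h4]

/-- Linear images of independent white vectors are independent white vectors as soon as their
coefficient rows are orthogonal with respect to the variances: uncorrelated jointly Gaussian
vectors are independent. -/
lemma linear_images_white {S ι : Type*} [Fintype S] [Fintype ι] [DecidableEq ι]
    {V : S → Ω → CVec n} (hV : iIndepFun V μ) {σ : S → ℝ} (hσ : ∀ s, IsWhite μ (V s) (σ s))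
    {a : ι → S → ℂ} {c : ι → ℝ}
    (ha : ∀ i i', ∑ s, (σ s : ℂ) * (a i s * star (a i' s)) = if i = i' then (c i : ℂ) else 0) :
    iIndepFun (fun i ω => ∑ s, a i s • V s ω) μ ∧
      ∀ i, IsWhite μ (fun ω => ∑ s, a i s • V s ω) (c i) := by
  have key := integral_exp_linear_images hV hσ ha
  have hmeas : ∀ s, Measurable (V s) := fun s => (hσ s).1
  have hm : ∀ i, Measurable (fun ω => ∑ s, a i s • V s ω) := fun i => by fun_prop
  have hw : ∀ i, IsWhite μ (fun ω => ∑ s, a i s • V s ω) (c i) := by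
    refine fun i => isWhite_iff.mpr ⟨hm i, fun t => ?_⟩
    have := key (Pi.single i t)
    rw [Finset.prod_eq_single i (fun b _ hb => by simp [hb]) (by simp)] at this
    simp only [Pi.single_eq_same] at this
    rw [← this]
    refine integral_congr_ae (.of_forall fun ω => ?_)
    simp only
    rw [Finset.sum_eq_single i (fun b _ hb => by simp [hb]) (by simp), Pi.single_eq_same]
  refine ⟨(iIndepFun_iff_charFun_pi fun i => (hm i).aemeasurable).mpr fun t => ?_, hw⟩
  simp only [charFun_map (hm _), fun i => (isWhite_iff.mp (hw i)).2]
  rw [← key t.ofLp, charFun_apply, integral_map]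
  · refine integral_congr_ae (.of_forall fun ω => ?_)
    beta_reduce
    rw [PiLp.inner_apply, mul_comm, Complex.re_sum]
    congr 3
    refine Finset.sum_congr rfl fun i _ => ?_
    rw [← real_inner_eq_re_inner, real_inner_comm]
  · exact (Measurable.aemeasurable (by fun_prop))
  · fun_prop

/-- The coordinates of a white vector along a system which is orthonormal for the real inner
product are independent. -/
lemma IsWhite.iIndepFun_re_inner {X : Ω → CVec n} {c : ℝ} (hc : 0 ≤ c) (hX : IsWhite μ X c)
    {ι : Type*} [Fintype ι] [DecidableEq ι] {u : ι → CVec n}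
    (hu : ∀ i j, (inner ℂ (u i) (u j)).re = if i = j then 1 else 0) :
    iIndepFun (fun i ω => (inner ℂ (u i) (X ω)).re) μ := by
  have hXm := hX.1
  have hm : ∀ i, Measurable (fun ω => (inner ℂ (u i) (X ω)).re) := fun i => by fun_prop
  refine (iIndepFun_iff_charFun_pi fun i => (hm i).aemeasurable).mpr fun t => ?_
  have h1 : ∀ i, charFun (μ.map fun ω => (inner ℂ (u i) (X ω)).re) (t.ofLp i)
      = Complex.exp ((-(c * t.ofLp i ^ 2 / 4) : ℝ)) := by
    intro i
    have h2 := hu i i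
    have h3 : ‖u i‖ ^ 2 = 1 := by
      rw [if_pos rfl] at h2
      rw [← h2]; exact norm_sq_eq_re_inner (𝕜 := ℂ) (u i)
    rw [IsCN.map_re_inner hX (posSemidef_smul_one hc), re_star_dotProduct_smul_one,
      charFun_gaussianReal, Real.coe_toNNReal _ (by positivity), h3]
    congr 1; push_cast; ring
  simp only [h1]
  rw [charFun_apply, integral_map (Measurable.aemeasurable (by fun_prop)) (by fun_prop),
    ← Complex.exp_sum, ← Complex.ofReal_sum]
  have h4 := (isWhite_iff.mp hX).2 (∑ i, (t.ofLp i : ℂ) • u i)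
  have h5 : ‖∑ i, (t.ofLp i : ℂ) • u i‖ ^ 2 = ∑ i, t.ofLp i ^ 2 := by
    rw [norm_sq_eq_re_inner (𝕜 := ℂ)]
    simp only [sum_inner, inner_sum, inner_smul_left, inner_smul_right, Complex.conj_ofReal,
      RCLike.re_eq_complex_re, Complex.re_sum, Complex.re_ofReal_mul, hu]
    simp [pow_two]
  rw [h5] at h4
  convert h4 using 2 with i
  · ext ω
    rw [mul_comm]
    congr 3
    simp [PiLp.inner_apply]
  · simp [Finset.mul_sum, Finset.sum_div]

/-- An odd function of a white vector integrates to zero, even in the presence of independent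
data: the law of a white vector is symmetric. -/
lemma IsCN.integral_odd_eq_zero {e : Ω → CVec n} {C : Matrix (Fin n) (Fin n) ℂ}
    (he : IsCN μ e C) {T : Type*} [MeasurableSpace T]
    {q : Ω → T} (hq : Measurable q) (hind : IndepFun e q μ) {F : CVec n → T → ℂ}
    (hF : Measurable (Function.uncurry F)) (hodd : ∀ x y, F (-x) y = -F x y) :
    ∫ ω, F (e ω) (q ω) ∂μ = 0 := by
  have hem := he.1
  have hneg : Measurable (fun ω => -e ω) := hem.neg
  have h1 : μ.map (fun ω => (e ω, q ω)) = μ.map (fun ω => (-e ω, q ω)) := by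
    have hind' : IndepFun (fun ω => -e ω) q μ := hind.comp measurable_neg measurable_id
    rw [(indepFun_iff_map_prod_eq_prod_map_map hem.aemeasurable hq.aemeasurable).mp hind,
      (indepFun_iff_map_prod_eq_prod_map_map hneg.aemeasurable hq.aemeasurable).mp hind',
      he.map_eq he.neg]
  have h2 : ∫ ω, F (e ω) (q ω) ∂μ = ∫ ω, F (-e ω) (q ω) ∂μ := by
    have := congrArg (fun ν => ∫ p, Function.uncurry F p ∂ν) h1
    beta_reduce at this
    rwa [integral_map (by fun_prop) hF.aestronglyMeasurable,
      integral_map (by fun_prop) hF.aestronglyMeasurable] at this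
  simp only [hodd, integral_neg] at h2
  exact self_eq_neg.mp h2

/-- The squared projection of a white vector on an independent vector. -/
lemma IsWhite.inner_indep {e w : Ω → CVec n} {c : ℝ} (hc : 0 ≤ c) (he : IsWhite μ e c)
    (hw : Measurable w) (hw2 : MemLp w 2 μ) (hind : IndepFun e w μ) :
    MemLp (fun ω => inner ℂ (e ω) (w ω)) 2 μ ∧
      ∫ ω, ‖(inner ℂ (e ω) (w ω) : ℂ)‖ ^ 2 ∂μ = c * ∫ ω, ‖w ω‖ ^ 2 ∂μ := by
  have hem := he.1
  have hprod := (indepFun_iff_map_prod_eq_prod_map_map hem.aemeasurable hw.aemeasurable).mp hind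
  have := Measure.isProbabilityMeasure_map (μ := μ) hem.aemeasurable
  have := Measure.isProbabilityMeasure_map (μ := μ) hw.aemeasurable
  set F : CVec n × CVec n → ℝ := fun p => ‖(inner ℂ p.1 p.2 : ℂ)‖ ^ 2 with hF
  have hFm : Measurable F := by fun_prop
  have hin : ∀ y, ∫ x, F (x, y) ∂(μ.map e) = c * ‖y‖ ^ 2 := by
    intro y
    rw [← IsWhite.integral_norm_inner_sq hc (IsCN.map_id he) y]
    simp only [hF, id, norm_inner_symm]
  have hwi : Integrable (fun y => ‖y‖ ^ 2) (μ.map w) := by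
    rw [integrable_map_measure (by fun_prop) hw.aemeasurable]
    exact hw2.integrable_norm_pow (by norm_num)
  have hint : Integrable F ((μ.map e).prod (μ.map w)) := by
    rw [integrable_prod_iff' hFm.aestronglyMeasurable]
    constructor
    · refine .of_forall fun y => ?_
      have := (IsCN.memLp_inner (IsCN.map_id he) (posSemidef_smul_one hc) y).integrable_norm_pow
        (by norm_num)
      simpa only [hF, norm_inner_symm y, id] using this
    · have : ∀ y, ∫ x, ‖F (x, y)‖ ∂(μ.map e) = c * ‖y‖ ^ 2 := by
        intro y
        rw [← hin y]
        refine integral_congr_ae (.of_forall fun x => ?_)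
        simp [hF]
      simp only [this]
      exact hwi.const_mul c
  have hval : ∫ p, F p ∂((μ.map e).prod (μ.map w)) = c * ∫ ω, ‖w ω‖ ^ 2 ∂μ := by
    rw [integral_prod_symm _ hint]
    simp only [hin]
    rw [integral_const_mul, integral_map hw.aemeasurable (by fun_prop)]
  rw [← hprod] at hint hval
  rw [integrable_map_measure (by fun_prop) (by fun_prop)] at hint
  rw [integral_map (by fun_prop) (by fun_prop)] at hval
  refine ⟨?_, hval⟩
  exact (memLp_two_iff_integrable_sq_norm (by fun_prop)).mpr hint

/-- Projections of centred white vectors `e m` on vectors `w m` are uncorrelated over `m` if each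
`e m` is independent of all `w` and of all the other `e`, so the variance of a linear combination
is the sum of the variances. -/
lemma memLp_integral_norm_sum_inner_sq {ι : Type*} [Fintype ι] [DecidableEq ι]
    {e w : ι → Ω → CVec n} {c : ι → ℝ} (hc : ∀ m, 0 ≤ c m) (he : ∀ m, IsWhite μ (e m) (c m))
    (hw : ∀ m, Measurable (w m)) (hw2 : ∀ m, MemLp (w m) 2 μ)
    (hind : ∀ m, IndepFun (e m)
      (fun ω => ((fun i => w i ω), Function.update (fun i => e i ω) m 0)) μ) (s : ι → ℝ) :
    MemLp (fun ω => ∑ m, (s m : ℂ) * inner ℂ (e m ω) (w m ω)) 2 μ ∧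
      ∫ ω, ‖∑ m, (s m : ℂ) * inner ℂ (e m ω) (w m ω)‖ ^ 2 ∂μ
        = ∑ m, s m ^ 2 * (c m * ∫ ω, ‖w m ω‖ ^ 2 ∂μ) := by
  have hem : ∀ m, Measurable (e m) := fun m => (he m).1
  have h1 : ∀ m, IndepFun (e m) (w m) μ := fun m =>
    (hind m).comp measurable_id ((measurable_pi_apply m).comp measurable_fst)
  have hL : ∀ m, MemLp (fun ω => (s m : ℂ) * inner ℂ (e m ω) (w m ω)) 2 μ := fun m =>
    ((he m).inner_indep (hc m) (hw m) (hw2 m) (h1 m)).1.const_mul _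
  refine ⟨memLp_finsetSum _ fun m _ => hL m, ?_⟩
  set f : ι → Ω → ℂ := fun m ω => (s m : ℂ) * inner ℂ (e m ω) (w m ω) with hf
  have hcross : ∀ m m', m ≠ m' → ∫ ω, f m ω * star (f m' ω) ∂μ = 0 := by
    intro m m' hne
    have hq : Measurable (fun ω => ((fun i => w i ω), Function.update (fun i => e i ω) m 0)) := by
      refine Measurable.prodMk (by fun_prop) (measurable_pi_iff.mpr fun i => ?_)
      by_cases h : i = m
      · subst h; simp
      · simpa [Function.update_of_ne h] using hem i
    have := IsCN.integral_odd_eq_zero (he m) hq (hind m)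
      (F := fun x p => (s m : ℂ) * inner ℂ x (p.1 m) *
        star ((s m' : ℂ) * inner ℂ (p.2 m') (p.1 m')))
      (by unfold Function.uncurry; fun_prop) (fun x y => by simp)
    simpa [hf, Function.update_of_ne hne.symm] using this
  have hII : ∀ m m', Integrable (fun ω => f m ω * star (f m' ω)) μ := fun m m' =>
    (hL m).integrable_mul (hL m').star
  have hexp : ∀ ω, ((‖∑ m, f m ω‖ ^ 2 : ℝ) : ℂ) = ∑ m, ∑ m', f m ω * star (f m' ω) := by
    intro ω
    rw [← Finset.sum_mul_sum, ← star_sum, Complex.star_def, Complex.mul_conj]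
    simp [Complex.normSq_eq_norm_sq]
  apply Complex.ofReal_injective
  rw [← integral_complex_ofReal]
  change ∫ ω, ((‖∑ m, f m ω‖ ^ 2 : ℝ) : ℂ) ∂μ = _
  simp only [hexp]
  rw [integral_finsetSum _ fun m _ => integrable_finsetSum _ fun m' _ => hII m m', Complex.ofReal_sum]
  refine Finset.sum_congr rfl fun m _ => ?_
  rw [integral_finsetSum _ fun m' _ => hII m m',
    Finset.sum_eq_single m (fun b _ hb => hcross m b hb.symm) (by simp)]
  rw [← ((he m).inner_indep (hc m) (hw m) (hw2 m) (h1 m)).2, ← integral_const_mul,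
    ← integral_complex_ofReal]
  refine integral_congr_ae (.of_forall fun ω => ?_)
  simp only [Complex.star_def, Complex.mul_conj, hf, Complex.normSq_eq_norm_sq, norm_mul,
    Complex.norm_real, mul_pow, Real.norm_eq_abs, sq_abs]

end Independence

/-! ### Inverse moments of projected white vectors -/

section InverseNorm

open Set

/-- The Laplace transform of the square of a centred Gaussian variable. -/
lemma integral_exp_neg_mul_sq_gaussianReal {v : NNReal} (hv : v ≠ 0) {s : ℝ} (hs : 0 ≤ s) :
    ∫ x, Real.exp (-s * x ^ 2) ∂(gaussianReal 0 v) = (√(1 + 2 * s * v))⁻¹ := by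
  have hv' : (0 : ℝ) < v := by positivity
  rw [integral_gaussianReal_eq_integral_smul hv]
  have h : ∀ x : ℝ, gaussianPDFReal 0 v x • Real.exp (-s * x ^ 2)
      = (√(2 * Real.pi * v))⁻¹ * Real.exp (-(1 / (2 * v) + s) * x ^ 2) := by
    intro x
    rw [gaussianPDFReal, smul_eq_mul, mul_assoc, ← Real.exp_add]
    congr 2
    field_simp
    ring
  simp only [h]
  rw [integral_const_mul, integral_gaussian, ← Real.sqrt_inv, ← Real.sqrt_mul (by positivity),
    ← Real.sqrt_inv]
  congr 1
  have := Real.pi_pos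
  field_simp

/-- `∫₀^∞ (1 + s c)^{-(p+1)} ds = 1 / (c p)`. -/
lemma lintegral_inv_one_add_mul_pow {c : ℝ} (hc : 0 < c) {p : ℕ} (hp : 0 < p) :
    ∫⁻ s in Ioi (0 : ℝ), ENNReal.ofReal (((1 + s * c)⁻¹) ^ (p + 1))
      = ENNReal.ofReal ((c * p)⁻¹) := by
  have hp' : (0 : ℝ) < p := by exact_mod_cast hp
  set F : ℝ → ℝ := fun s => -((c * p)⁻¹ * ((1 + s * c) ^ p)⁻¹) with hF
  have hd : ∀ x ∈ Ici (0 : ℝ), HasDerivAt F (((1 + x * c)⁻¹) ^ (p + 1)) x := by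
    intro x hx
    have hx0 : (0 : ℝ) ≤ x := hx
    have h1 : 0 < 1 + x * c := by positivity
    have h2 : HasDerivAt (fun s : ℝ => 1 + s * c) c x := by
      simpa using ((hasDerivAt_id x).mul_const c).const_add 1
    have h3 := (((h2.pow p).inv (pow_pos h1 p).ne').const_mul (c * p)⁻¹).neg
    refine HasDerivAt.congr_deriv (f := F) h3 ?_
    obtain ⟨q, rfl⟩ : ∃ q, p = q + 1 := ⟨p - 1, by omega⟩
    rw [Nat.add_sub_cancel, Pi.pow_apply, inv_pow]
    field_simp
    ring
  have hpos : ∀ x ∈ Ioi (0 : ℝ), 0 ≤ ((1 + x * c)⁻¹) ^ (p + 1) := by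
    intro x hx
    have hx0 : (0 : ℝ) < x := hx
    positivity
  have hlim : Filter.Tendsto F Filter.atTop (nhds 0) := by
    have h1 : Filter.Tendsto (fun s : ℝ => (1 + s * c) ^ p) Filter.atTop Filter.atTop :=
      (Filter.tendsto_pow_atTop hp.ne').comp
        (Filter.tendsto_atTop_add_const_left _ _ (Filter.tendsto_id.atTop_mul_const hc))
    simpa only [Function.comp_def, mul_zero, neg_zero] using
      ((tendsto_inv_atTop_zero.comp h1).const_mul (c * p)⁻¹).neg
  have hint := integrableOn_Ioi_deriv_of_nonneg' hd hpos hlim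
  have hval := integral_Ioi_of_hasDerivAt_of_nonneg' hd hpos hlim
  rw [← ofReal_integral_eq_lintegral_ofReal hint
    ((ae_restrict_iff' measurableSet_Ioi).mpr (.of_forall hpos)), hval]
  simp [hF]

lemma lintegral_exp_neg_mul {q : ℝ} (hq : 0 < q) :
    ∫⁻ s in Ioi (0 : ℝ), ENNReal.ofReal (Real.exp (-s * q)) = ENNReal.ofReal (q⁻¹) := by
  have h : ∀ s : ℝ, -s * q = -q * s := fun s => by ring
  simp only [h]
  rw [← ofReal_integral_eq_lintegral_ofReal _ (.of_forall fun s => (Real.exp_pos _).le),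
    integral_exp_mul_Ioi (by linarith)]
  · simp
  · exact integrableOn_exp_mul_Ioi (by linarith) 0

variable {Ω : Type*} [MeasurableSpace Ω] {μ : Measure Ω} [IsProbabilityMeasure μ] {n : ℕ}

/-- A nondegenerate white vector almost surely avoids a given hyperplane. -/
lemma IsWhite.ae_inner_ne_zero {X : Ω → CVec n} {c : ℝ} (hc : 0 < c) (hX : IsWhite μ X c)
    {v : CVec n} (hv : v ≠ 0) : ∀ᵐ ω ∂μ, (inner ℂ v (X ω) : ℂ) ≠ 0 := by
  have hXm := hX.1
  have h1 := IsCN.map_re_inner hX (posSemidef_smul_one hc.le) v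
  rw [re_star_dotProduct_smul_one] at h1
  have hvar : (c * ‖v‖ ^ 2 / 2).toNNReal ≠ 0 := by
    have : 0 < ‖v‖ := norm_pos_iff.mpr hv
    exact (Real.toNNReal_pos.mpr (by positivity)).ne'
  have := nullSingletonClass_gaussianReal (μ := 0) hvar
  have h2 : ∀ᵐ x ∂(μ.map fun ω => (inner ℂ v (X ω)).re), x ≠ 0 := by
    rw [h1]
    exact (measure_eq_zero_iff_ae_notMem.mp (measure_singleton (0 : ℝ)))
  have h3 := ae_of_ae_map (by fun_prop) h2
  filter_upwards [h3] with ω hω h0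
  exact hω (by rw [h0]; rfl)

/-- The Laplace transform of the squared norm of a white vector projected on the span of an
orthonormal system. -/
lemma IsWhite.integral_exp_neg_sum_inner_sq {X : Ω → CVec n} {c : ℝ} (hc : 0 < c)
    (hX : IsWhite μ X c) {d : ℕ} {v : Fin d → CVec n} (hv : Orthonormal ℂ v) {s : ℝ}
    (hs : 0 ≤ s) :
    ∫ ω, Real.exp (-s * ∑ i, ‖(inner ℂ (v i) (X ω) : ℂ)‖ ^ 2) ∂μ = ((1 + s * c)⁻¹) ^ d := by
  have hXm := hX.1
  -- real and imaginary parts of the projections are the coordinates along `v i` and `I • v i`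
  set u : Fin d × Bool → CVec n := fun a => (if a.2 then Complex.I else 1) • v a.1 with hu
  have hvv := orthonormal_iff_ite.mp hv
  have huu : ∀ a b, (inner ℂ (u a) (u b)).re = if a = b then 1 else 0 := by
    rintro ⟨i, x⟩ ⟨j, y⟩
    simp only [hu, inner_smul_left, inner_smul_right, hvv, Prod.mk.injEq]
    by_cases hij : i = j <;> cases x <;> cases y <;> simp [hij]
  have hind := IsWhite.iIndepFun_re_inner hc.le hX huu
  have hsum : ∀ ω, Real.exp (-s * ∑ i, ‖(inner ℂ (v i) (X ω) : ℂ)‖ ^ 2)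
      = ∏ a, Real.exp (-s * (inner ℂ (u a) (X ω)).re ^ 2) := by
    intro ω
    rw [← Real.exp_sum, ← Finset.mul_sum, Fintype.sum_prod_type]
    congr 2
    refine Finset.sum_congr rfl fun i _ => ?_
    simp [hu, Complex.sq_norm, Complex.normSq_apply, ← pow_two, add_comm]
  simp only [hsum]
  have h2 := (hind.comp (fun _ x => Real.exp (-s * x ^ 2))
    (fun _ => by fun_prop)).integral_fun_prod_eq_prod_integral
    (fun a => Measurable.aestronglyMeasurable (by fun_prop))
  simp only [Function.comp_apply] at h2
  rw [h2]
  have h3 : ∀ a, ∫ ω, Real.exp (-s * (inner ℂ (u a) (X ω)).re ^ 2) ∂μ = (√(1 + s * c))⁻¹ := by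
    intro a
    have hua : ‖u a‖ ^ 2 = 1 := by
      have h := huu a a
      rw [if_pos rfl] at h
      rw [← h]; exact norm_sq_eq_re_inner (𝕜 := ℂ) (u a)
    have h4 := IsCN.map_re_inner hX (posSemidef_smul_one hc.le) (u a)
    rw [re_star_dotProduct_smul_one, hua] at h4
    have h5 := integral_exp_neg_mul_sq_gaussianReal
      (v := (c * 1 / 2).toNNReal) (Real.toNNReal_pos.mpr (by positivity)).ne' hs
    rw [← h4, integral_map (by fun_prop) (by fun_prop), Real.coe_toNNReal _ (by positivity)] at h5
    rw [h5]
    congr 3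
    ring
  simp only [h3, Finset.prod_const, Finset.card_univ, Fintype.card_prod, Fintype.card_fin,
    Fintype.card_bool]
  rw [mul_comm d 2, pow_mul, inv_pow, Real.sq_sqrt (by positivity)]

/-- The inverse moment of the squared norm of a white vector projected on a subspace of dimension
`p + 1`: a Gamma distributed variable with shape `p + 1` has inverse moment proportional to
`1 / p`. -/
lemma IsWhite.lintegral_inv_sum_inner_sq {X : Ω → CVec n} {c : ℝ} (hc : 0 < c)
    (hX : IsWhite μ X c) {p : ℕ} (hp : 0 < p) {v : Fin (p + 1) → CVec n}
    (hv : Orthonormal ℂ v) :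
    ∫⁻ ω, ENNReal.ofReal ((∑ i, ‖(inner ℂ (v i) (X ω) : ℂ)‖ ^ 2)⁻¹) ∂μ
      = ENNReal.ofReal ((c * p)⁻¹) := by
  have hXm := hX.1
  set Q : Ω → ℝ := fun ω => ∑ i, ‖(inner ℂ (v i) (X ω) : ℂ)‖ ^ 2 with hQ
  have hQm : Measurable Q := by fun_prop
  have hQpos : ∀ᵐ ω ∂μ, 0 < Q ω := by
    filter_upwards [hX.ae_inner_ne_zero hc (hv.ne_zero 0)] with ω hω
    refine Finset.sum_pos' (fun i _ => by positivity) ⟨0, Finset.mem_univ _, ?_⟩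
    have := norm_pos_iff.mpr hω
    positivity
  have h1 : ∫⁻ ω, ENNReal.ofReal ((Q ω)⁻¹) ∂μ
      = ∫⁻ ω, (∫⁻ s in Ioi (0 : ℝ), ENNReal.ofReal (Real.exp (-s * Q ω))) ∂μ := by
    refine lintegral_congr_ae ?_
    filter_upwards [hQpos] with ω hω
    exact (lintegral_exp_neg_mul hω).symm
  rw [h1, lintegral_lintegral_swap (by unfold Function.uncurry; fun_prop),
    ← lintegral_inv_one_add_mul_pow hc hp]
  refine setLIntegral_congr_fun measurableSet_Ioi fun s hs => ?_
  have hs0 : (0 : ℝ) ≤ s := le_of_lt hs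
  rw [← hX.integral_exp_neg_sum_inner_sq hc hv hs0]
  have hQ0 : ∀ ω, 0 ≤ Q ω := fun ω => Finset.sum_nonneg fun i _ => by positivity
  rw [ofReal_integral_eq_lintegral_ofReal]
  · refine Integrable.of_bound (C := 1) (by fun_prop) (.of_forall fun ω => ?_)
    rw [Real.norm_eq_abs, abs_of_pos (Real.exp_pos _), Real.exp_le_one_iff]
    have := mul_nonneg hs0 (hQ0 ω)
    simp only [hQ] at this
    linarith
  · exact .of_forall fun ω => (Real.exp_pos _).le

end InverseNorm

/-! ### Algebra of zero-forcing and protective precoding -/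

section ZeroForcing

variable {Ω : Type*} {L K J : ℕ}

lemma toLp_colMatrix_mulVec (gI : Fin K → Ω → CVec L) (ω : Ω) (c : Fin K → ℂ) :
    WithLp.toLp 2 (colMatrix gI ω *ᵥ c) = ∑ i, c i • gI i ω := by
  ext l
  simp [colMatrix, Matrix.mulVec, dotProduct, mul_comm]

lemma conjTranspose_colMatrix_mulVec (gI : Fin K → Ω → CVec L) (ω : Ω) (x : CVec L) (i : Fin K) :
    ((colMatrix gI ω)ᴴ *ᵥ x.ofLp) i = inner ℂ (gI i ω) x := by
  simp [colMatrix, Matrix.mulVec, dotProduct, PiLp.inner_apply, mul_comm]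

lemma isUnit_gram {gI : Fin K → Ω → CVec L} {ω : Ω}
    (h : LinearIndependent ℂ fun i => gI i ω) :
    IsUnit ((colMatrix gI ω)ᴴ * colMatrix gI ω) := by
  refine (Matrix.PosDef.conjTranspose_mul_self _ ?_).isUnit
  rw [Matrix.mulVec_injective_iff]
  exact h.map' (WithLp.linearEquiv 2 ℂ (Fin L → ℂ)).toLinearMap (LinearEquiv.ker _)

/-- Zero-forcing directions are biorthogonal to the channels. -/
lemma inner_zfDir {gI : Fin K → Ω → CVec L} {ω : Ω}
    (h : LinearIndependent ℂ fun i => gI i ω) (i k : Fin K) :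
    inner ℂ (gI i ω) (zfDir gI k ω) = if i = k then 1 else 0 := by
  have hdet := (Matrix.isUnit_iff_isUnit_det _).mp (isUnit_gram h)
  rw [← conjTranspose_colMatrix_mulVec]
  simp only [zfDir]
  rw [Matrix.mulVec_mulVec, ← Matrix.mul_assoc, Matrix.mul_nonsing_inv _ hdet, Matrix.one_mulVec,
    Pi.single_apply]

lemma zfDir_eq_sum (gI : Fin K → Ω → CVec L) (k : Fin K) (ω : Ω) :
    ∃ c : Fin K → ℂ, zfDir gI k ω = ∑ i, c i • gI i ω := by
  refine ⟨((colMatrix gI ω)ᴴ * colMatrix gI ω)⁻¹ *ᵥ Pi.single k 1, ?_⟩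
  rw [← toLp_colMatrix_mulVec]
  simp only [zfDir, Matrix.mulVec_mulVec]

/-- The zero-forcing direction is the component of its channel orthogonal to the other channels,
rescaled to unit gain, so its norm is the inverse of the norm of that component. -/
lemma norm_zfDir_sq {n d : ℕ} {p : Fin (n + 1)} {g : Fin (n + 1) → CVec L}
    (h : LinearIndependent ℂ g) {V : Submodule ℂ (CVec L)}
    (hV : V = (Submodule.span ℂ (Set.range fun i => g (p.succAbove i)))ᗮ)
    (b : OrthonormalBasis (Fin d) ℂ V) :
    ‖zfDir (fun i (f : Fin (n + 1) → CVec L) => f i) p g‖ ^ 2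
      = (∑ i, ‖(inner ℂ (b i : CVec L) (g p) : ℂ)‖ ^ 2)⁻¹ := by
  set w := zfDir (fun i (f : Fin (n + 1) → CVec L) => f i) p g with hw
  have hin : ∀ i, inner ℂ (g i) w = if i = p then (1 : ℂ) else 0 := fun i =>
    inner_zfDir (gI := fun i (f : Fin (n + 1) → CVec L) => f i) h i p
  have hwV : w ∈ V := by
    rw [hV, Submodule.mem_orthogonal]
    intro u hu
    refine Submodule.span_induction (fun x hx => ?_) (by simp) (fun x y _ _ hx hy => by
      rw [inner_add_left, hx, hy, add_zero]) (fun a x _ hx => by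
      rw [inner_smul_left, hx, mul_zero]) hu
    obtain ⟨i, rfl⟩ := hx
    rw [hin, if_neg (Fin.succAbove_ne p i)]
  obtain ⟨c, hc⟩ := zfDir_eq_sum (fun i (f : Fin (n + 1) → CVec L) => f i) p g
  rw [← hw] at hc
  have hy : ∀ y ∈ V, inner ℂ y w = c p * inner ℂ y (g p) := by
    intro y hy
    rw [hc, inner_sum, Finset.sum_eq_single p]
    · rw [inner_smul_right]
    · intro j _ hj
      obtain ⟨i, rfl⟩ := Fin.exists_succAbove_eq hj
      rw [inner_smul_right]
      rw [hV] at hy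
      have := Submodule.inner_left_of_mem_orthogonal
        (Submodule.subset_span (Set.mem_range_self i)) hy
      rw [this, mul_zero]
    · simp
  have hwp : inner ℂ w (g p) = (1 : ℂ) := by
    rw [← inner_conj_symm, hin, if_pos rfl, map_one]
  have hcp : c p = (‖w‖ : ℂ) ^ 2 := by
    have := hy w hwV
    rw [hwp, mul_one] at this
    rw [← this]; exact inner_self_eq_norm_sq_to_K w
  have hpars : ∑ i, ‖(inner ℂ (b i : CVec L) w : ℂ)‖ ^ 2 = ‖w‖ ^ 2 := by
    have := b.sum_sq_norm_inner_right ⟨w, hwV⟩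
    simpa using this
  have hw0 : w ≠ 0 := by
    intro h0
    rw [h0, inner_zero_left] at hwp
    exact zero_ne_one hwp
  have hwn : ‖w‖ ^ 2 ≠ 0 := by
    have := norm_pos_iff.mpr hw0
    positivity
  simp only [fun i => hy (b i) (b i).2, norm_mul, mul_pow, ← Finset.mul_sum, hcp] at hpars
  rw [norm_pow, Complex.norm_real, norm_norm] at hpars
  exact eq_inv_of_mul_eq_one_left (mul_left_cancel₀ hwn (by linear_combination hpars))

lemma pmrtDir_eq (gI : Fin K → Ω → CVec L) (gE : Fin J → Ω → CVec L) (j : Fin J) (ω : Ω) :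
    ∃ c : Fin K → ℂ, pmrtDir gI gE j ω = gE j ω - ∑ i, c i • gI i ω := by
  refine ⟨(((colMatrix gI ω)ᴴ * colMatrix gI ω)⁻¹ * (colMatrix gI ω)ᴴ) *ᵥ (gE j ω).ofLp, ?_⟩
  rw [← toLp_colMatrix_mulVec]
  have h1 : colMatrix gE ω *ᵥ Pi.single j 1 = (gE j ω).ofLp := by
    ext l
    simp [colMatrix]
  simp only [pmrtDir, nullProj]
  rw [← Matrix.mulVec_mulVec, h1, Matrix.sub_mulVec, Matrix.one_mulVec, Matrix.mulVec_mulVec,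
    ← Matrix.mul_assoc]
  rfl

/-- Protective maximum ratio directions are orthogonal to the channels of the information users. -/
lemma inner_pmrtDir {gI : Fin K → Ω → CVec L} {ω : Ω}
    (h : LinearIndependent ℂ fun i => gI i ω) (gE : Fin J → Ω → CVec L) (i : Fin K) (j : Fin J) :
    inner ℂ (gI i ω) (pmrtDir gI gE j ω) = 0 := by
  have hdet := (Matrix.isUnit_iff_isUnit_det _).mp (isUnit_gram h)
  rw [← conjTranspose_colMatrix_mulVec]
  simp only [pmrtDir, nullProj]
  rw [Matrix.mulVec_mulVec, ← Matrix.mul_assoc, Matrix.mul_sub, ← Matrix.mul_assoc,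
    ← Matrix.mul_assoc, Matrix.mul_nonsing_inv _ hdet]
  simp

lemma norm_pmrtDir_le {gI : Fin K → Ω → CVec L} {ω : Ω}
    (h : LinearIndependent ℂ fun i => gI i ω) (gE : Fin J → Ω → CVec L) (j : Fin J) :
    ‖pmrtDir gI gE j ω‖ ≤ ‖gE j ω‖ := by
  obtain ⟨c, hc⟩ := pmrtDir_eq gI gE j ω
  have h1 : inner ℂ (∑ i, c i • gI i ω) (pmrtDir gI gE j ω) = 0 := by
    simp [inner_pmrtDir h]
  have h2 : gE j ω = ∑ i, c i • gI i ω + pmrtDir gI gE j ω := by rw [hc]; abel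
  have h3 := norm_add_sq_eq_norm_sq_add_norm_sq_of_inner_eq_zero _ _ h1
  rw [← h2] at h3
  refine le_of_sq_le_sq ?_ (norm_nonneg _)
  nlinarith [mul_self_nonneg ‖∑ i, c i • gI i ω‖]

lemma pmrtDir_ne_zero {gI : Fin K → Ω → CVec L} {gE : Fin J → Ω → CVec L} {ω : Ω} {j : Fin J}
    (h : LinearIndependent ℂ (Fin.snoc (fun i => gI i ω) (gE j ω) : Fin (K + 1) → CVec L)) :
    pmrtDir gI gE j ω ≠ 0 := by
  intro h0
  obtain ⟨c, hc⟩ := pmrtDir_eq gI gE j ω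
  rw [h0, eq_comm, sub_eq_zero] at hc
  refine (linearIndependent_finSnoc.mp h).2 ?_
  rw [hc]
  exact Submodule.sum_mem _ fun i _ => Submodule.smul_mem _ _
    (Submodule.subset_span (Set.mem_range_self i))

section Measurability

variable [MeasurableSpace Ω]

lemma measurable_colMatrix {gI : Fin K → Ω → CVec L} (hg : ∀ i, Measurable (gI i)) (l : Fin L)
    (i : Fin K) : Measurable fun ω => colMatrix gI ω l i := by
  have := hg i
  simp only [colMatrix, Matrix.of_apply]
  fun_prop

lemma measurable_gram_inv {gI : Fin K → Ω → CVec L} (hg : ∀ i, Measurable (gI i)) (i j : Fin K) :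
    Measurable fun ω => ((colMatrix gI ω)ᴴ * colMatrix gI ω)⁻¹ i j := by
  have hc : Continuous fun g : Fin K → CVec L =>
      (Matrix.of fun l u => g u l : Matrix (Fin L) (Fin K) ℂ) := by fun_prop
  have hG : Continuous fun g : Fin K → CVec L =>
      (Matrix.of fun l u => g u l : Matrix (Fin L) (Fin K) ℂ)ᴴ * (Matrix.of fun l u => g u l) :=
    hc.matrix_conjTranspose.matrix_mul hc
  have h1 : Measurable fun g : Fin K → CVec L =>
      ((Matrix.of fun l u => g u l : Matrix (Fin L) (Fin K) ℂ)ᴴ *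
        (Matrix.of fun l u => g u l))⁻¹ i j := by
    simp only [Matrix.inv_def, Ring.inverse_eq_inv', Matrix.smul_apply, smul_eq_mul]
    exact hG.matrix_det.measurable.inv.mul (hG.matrix_adjugate.matrix_elem i j).measurable
  exact h1.comp (measurable_pi_iff.mpr hg)

lemma measurable_zfDir {gI : Fin K → Ω → CVec L} (hg : ∀ i, Measurable (gI i)) (k : Fin K) :
    Measurable (zfDir gI k) := by
  have h : Measurable fun ω => (colMatrix gI ω * ((colMatrix gI ω)ᴴ * colMatrix gI ω)⁻¹) *ᵥ
      (Pi.single k 1 : Fin K → ℂ) := by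
    refine measurable_pi_iff.mpr fun l => ?_
    simp only [Matrix.mulVec_single_one, Matrix.col_apply, Matrix.mul_apply (M := colMatrix gI _)]
    exact Finset.measurable_sum _ fun i _ =>
      (measurable_colMatrix hg l i).mul (measurable_gram_inv hg i k)
  exact (WithLp.measurable_toLp 2 _).comp h

lemma measurable_pmrtDir {gI : Fin K → Ω → CVec L} {gE : Fin J → Ω → CVec L}
    (hg : ∀ i, Measurable (gI i)) (hE : ∀ j, Measurable (gE j)) (j : Fin J) :
    Measurable (pmrtDir gI gE j) := by
  have h1 : ∀ i l, Measurable fun ω =>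
      (colMatrix gI ω * ((colMatrix gI ω)ᴴ * colMatrix gI ω)⁻¹) l i := fun i l => by
    simp only [Matrix.mul_apply (M := colMatrix gI _)]
    exact Finset.measurable_sum _ fun i' _ =>
      (measurable_colMatrix hg l i').mul (measurable_gram_inv hg i' i)
  have h2 : ∀ l l', Measurable fun ω => nullProj gI ω l l' := fun l l' => by
    simp only [nullProj, Matrix.sub_apply]
    refine measurable_const.sub ?_
    simp only [Matrix.mul_apply (N := (colMatrix gI _)ᴴ)]
    exact Finset.measurable_sum _ fun i _ =>
      (h1 i l).mul ((continuous_star.measurable).comp (measurable_colMatrix hg l' i))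
  have h : Measurable fun ω => (nullProj gI ω * colMatrix gE ω) *ᵥ
      (Pi.single j 1 : Fin J → ℂ) := by
    refine measurable_pi_iff.mpr fun l => ?_
    simp only [Matrix.mulVec_single_one, Matrix.col_apply, Matrix.mul_apply]
    exact Finset.measurable_sum _ fun i _ => (h2 l i).mul (measurable_colMatrix hE i j)
  exact (WithLp.measurable_toLp 2 _).comp h

end Measurability
end ZeroForcing

/-! ### Matrices with independent white columns -/

section RandomMatrix

variable {L : ℕ}

/-- A property which holds almost surely in the first variable for almost every second one holds
almost surely for the product measure. -/
lemma ae_prod_of_ae_ae_swap {α β : Type*} [MeasurableSpace α] [MeasurableSpace β] {μ : Measure α}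
    {ν : Measure β} [SFinite μ] [SFinite ν] {p : α × β → Prop} (hp : MeasurableSet {z | p z})
    (h : ∀ᵐ y ∂ν, ∀ᵐ x ∂μ, p (x, y)) : ∀ᵐ z ∂μ.prod ν, p z := by
  rw [ae_iff, Measure.prod_apply_symm (by exact hp.compl)]
  exact lintegral_eq_zero_of_ae_eq_zero (by filter_upwards [h] with y hy using hy)

/-- A nondegenerate white vector almost surely avoids a given proper subspace. -/
lemma ae_notMem_of_isWhite {ν : Measure (CVec L)} [IsProbabilityMeasure ν] {c : ℝ} (hc : 0 < c)
    (hν : IsWhite ν id c) {S : Submodule ℂ (CVec L)} (hS : S ≠ ⊤) : ∀ᵐ x ∂ν, x ∉ S := by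
  obtain ⟨v, hvS, hv⟩ := Submodule.exists_mem_ne_zero_of_ne_bot
    (mt Submodule.orthogonal_eq_bot_iff.mp hS)
  filter_upwards [hν.ae_inner_ne_zero hc hv] with x hx hxS
  exact hx (Submodule.inner_left_of_mem_orthogonal hxS hvS)

lemma span_range_ne_top {n : ℕ} (hn : n < L) (g : Fin n → CVec L) :
    Submodule.span ℂ (Set.range g) ≠ ⊤ := by
  intro h
  have h1 := finrank_range_le_card (R := ℂ) g
  rw [Set.finrank, h, finrank_top, finrank_euclideanSpace] at h1
  simp only [Fintype.card_fin] at h1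
  omega

/-- Fewer than `L` independent nondegenerate white vectors of length `L` are almost surely linearly
independent, even together with a given nonzero vector. -/
lemma ae_linearIndependent_snoc {n : ℕ} (hn : n < L) {ν : Fin n → Measure (CVec L)}
    [∀ i, IsProbabilityMeasure (ν i)] {c : Fin n → ℝ} (hc : ∀ i, 0 < c i)
    (hν : ∀ i, IsWhite (ν i) id (c i)) {x : CVec L} (hx : x ≠ 0) :
    ∀ᵐ g ∂(Measure.pi ν), LinearIndependent ℂ (Fin.snoc g x : Fin (n + 1) → CVec L) := by
  have hmeas : ∀ m : ℕ, MeasurableSet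
      {g : Fin m → CVec L | LinearIndependent ℂ (Fin.snoc g x : Fin (m + 1) → CVec L)} := by
    intro m
    refine (isOpen_setOfPred_linearIndependent.preimage
      (f := fun g : Fin m → CVec L => (Fin.snoc g x : Fin (m + 1) → CVec L)) ?_).measurableSet
    fun_prop
  induction n with
  | zero =>
    refine .of_forall fun g => ?_
    rw [linearIndependent_finSnoc]
    refine ⟨linearIndependent_empty_type, ?_⟩
    simpa using hx
  | succ n ih =>
    have hmp := measurePreserving_piFinSuccAbove ν 0
    have ih' := ih (by omega) (fun i => hc (Fin.succAbove 0 i)) (fun i => hν (Fin.succAbove 0 i))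
    have hkey : ∀ᵐ z ∂(ν 0).prod (Measure.pi fun j => ν (Fin.succAbove 0 j)),
        LinearIndependent ℂ (Fin.snoc ((MeasurableEquiv.piFinSuccAbove (fun _ => CVec L) 0).symm z)
          x : Fin (n + 1 + 1) → CVec L) := by
      refine ae_prod_of_ae_ae_swap ((hmeas (n + 1)).preimage
        (MeasurableEquiv.piFinSuccAbove (fun _ => CVec L) 0).symm.measurable) ?_
      filter_upwards [ih'] with g hg
      filter_upwards [ae_notMem_of_isWhite (hc 0) (hν 0)
        (span_range_ne_top hn (Fin.snoc g x : Fin (n + 1) → CVec L))] with y hy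
      have : (MeasurableEquiv.piFinSuccAbove (fun _ : Fin (n + 1) => CVec L) 0).symm (y, g)
          = Fin.cons y g := by
        simp [MeasurableEquiv.piFinSuccAbove, Fin.insertNthEquiv]
      rw [this, ← Fin.cons_snoc_eq_snoc_cons, linearIndependent_finCons]
      exact ⟨hg, hy⟩
    filter_upwards [hmp.quasiMeasurePreserving.ae hkey] with g hg
    rwa [MeasurableEquiv.symm_apply_apply] at hg

lemma ae_linearIndependent {n : ℕ} (hn : n < L) {ν : Fin n → Measure (CVec L)}
    [∀ i, IsProbabilityMeasure (ν i)] {c : Fin n → ℝ} (hc : ∀ i, 0 < c i)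
    (hν : ∀ i, IsWhite (ν i) id (c i)) :
    ∀ᵐ g ∂(Measure.pi ν), LinearIndependent ℂ g := by
  have : Nontrivial (CVec L) := by
    have : Nonempty (Fin L) := ⟨⟨n, hn⟩⟩
    infer_instance
  obtain ⟨x, hx⟩ := exists_ne (0 : CVec L)
  filter_upwards [ae_linearIndependent_snoc hn hc hν hx] with g hg
  exact (linearIndependent_finSnoc.mp hg).1

/-- The second moment of the zero-forcing direction, that is, a diagonal entry of the mean of the
inverse of a complex Wishart matrix. -/
lemma lintegral_norm_zfDir_sq {n : ℕ} (hn : n + 1 < L) {ν : Fin (n + 1) → Measure (CVec L)}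
    [∀ i, IsProbabilityMeasure (ν i)] {c : Fin (n + 1) → ℝ} (hc : ∀ i, 0 < c i)
    (hν : ∀ i, IsWhite (ν i) id (c i)) (p : Fin (n + 1)) :
    ∫⁻ g, ENNReal.ofReal (‖zfDir (fun i (f : Fin (n + 1) → CVec L) => f i) p g‖ ^ 2)
      ∂(Measure.pi ν) = ENNReal.ofReal ((c p * (L - (n + 1) : ℝ))⁻¹) := by
  have hmp := measurePreserving_piFinSuccAbove ν p
  set E := MeasurableEquiv.piFinSuccAbove (fun _ : Fin (n + 1) => CVec L) p with hE
  have hzm := measurable_zfDir (L := L) (gI := fun i (f : Fin (n + 1) → CVec L) => f i)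
    (fun i => measurable_pi_apply i) p
  rw [← hmp.symm.lintegral_comp_emb E.symm.measurableEmbedding,
    lintegral_prod_symm' _ (by have := E.symm.measurable; fun_prop)]
  have hli := hmp.symm.quasiMeasurePreserving.ae (ae_linearIndependent (by omega) hc hν)
  have hli2 : ∀ᵐ g ∂(Measure.pi fun j => ν (p.succAbove j)), ∀ᵐ x ∂(ν p),
      LinearIndependent ℂ (E.symm (x, g)) :=
    Measure.ae_ae_of_ae_prod (Measure.measurePreserving_swap.quasiMeasurePreserving.ae hli)
  have hli3 := ae_linearIndependent (n := n) (by omega) (fun i => hc (p.succAbove i))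
    (fun i => hν (p.succAbove i))
  rw [lintegral_congr_ae (g := fun _ => ENNReal.ofReal ((c p * (L - (n + 1) : ℝ))⁻¹))]
  · simp
  filter_upwards [hli2, hli3] with g hg hg'
  obtain ⟨q, hq, hq0⟩ : ∃ q, L = n + (q + 1) ∧ 0 < q := ⟨L - (n + 1), by omega, by omega⟩
  have hdim : Module.finrank ℂ (Submodule.span ℂ (Set.range g))ᗮ = q + 1 := by
    have h1 := Submodule.finrank_add_finrank_orthogonal (Submodule.span ℂ (Set.range g))
    rw [finrank_span_eq_card hg', finrank_euclideanSpace] at h1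
    simp only [Fintype.card_fin] at h1
    omega
  have hs : ∀ x i, E.symm (x, g) (p.succAbove i) = g i := fun x i => by
    simp [hE, MeasurableEquiv.piFinSuccAbove, Fin.insertNthEquiv]
  have hsp : ∀ x, E.symm (x, g) p = x := fun x => by
    simp [hE, MeasurableEquiv.piFinSuccAbove, Fin.insertNthEquiv]
  let b : OrthonormalBasis (Fin (q + 1)) ℂ (Submodule.span ℂ (Set.range g))ᗮ :=
    (stdOrthonormalBasis ℂ _).reindex (finCongr hdim)
  have hb : Orthonormal ℂ fun i => (b i : CVec L) :=
    b.orthonormal.comp_linearIsometry (Submodule.subtypeₗᵢ _)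
  have h2 := (hν p).lintegral_inv_sum_inner_sq (hc p) hq0 hb
  have hcast : (L - (n + 1) : ℝ) = q := by rw [hq]; push_cast; ring
  rw [hcast, ← h2]
  refine lintegral_congr_ae ?_
  filter_upwards [hg] with x hx
  have hrange : (fun i => E.symm (x, g) (p.succAbove i)) = g := funext (hs x)
  rw [norm_zfDir_sq (p := p) hx (by rw [hrange]) b, hsp]
  rfl

end RandomMatrix

/-! ### Power of the precoding directions -/

section Precoding

variable {Ω : Type*} [MeasurableSpace Ω] {μ : Measure Ω} [IsProbabilityMeasure μ] {L K J : ℕ}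

lemma map_pi_eq {gI : Fin K → Ω → CVec L} (hg : ∀ i, Measurable (gI i)) (hind : iIndepFun gI μ) :
    μ.map (fun ω i => gI i ω) = Measure.pi fun i => μ.map (gI i) :=
  (iIndepFun_iff_map_fun_eq_pi_map fun i => (hg i).aemeasurable).mp hind

lemma ae_linearIndependent_of_iIndepFun (hKL : K < L) {gI : Fin K → Ω → CVec L}
    (hind : iIndepFun gI μ) {c : Fin K → ℝ} (hc : ∀ i, 0 < c i)
    (hw : ∀ i, IsWhite μ (gI i) (c i)) :
    ∀ᵐ ω ∂μ, LinearIndependent ℂ fun i => gI i ω := by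
  have hg : ∀ i, Measurable (gI i) := fun i => (hw i).1
  have := fun i => Measure.isProbabilityMeasure_map (μ := μ) (hg i).aemeasurable
  have h := ae_linearIndependent hKL hc (fun i => IsCN.map_id (hw i))
  rw [← map_pi_eq hg hind] at h
  have hm : AEMeasurable (fun ω i => gI i ω) μ := by fun_prop
  exact ae_of_ae_map (p := fun g : Fin K → CVec L => LinearIndependent ℂ g) hm h

lemma ae_linearIndependent_snoc_of_indepFun (hKL : K < L) {gI : Fin K → Ω → CVec L}
    (hind : iIndepFun gI μ) {c : Fin K → ℝ} (hc : ∀ i, 0 < c i)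
    (hw : ∀ i, IsWhite μ (gI i) (c i)) {x : Ω → CVec L} (hx : Measurable x)
    (hgx : IndepFun (fun ω i => gI i ω) x μ) :
    ∀ᵐ ω ∂μ, x ω ≠ 0 →
      LinearIndependent ℂ (Fin.snoc (fun i => gI i ω) (x ω) : Fin (K + 1) → CVec L) := by
  have hg : ∀ i, Measurable (gI i) := fun i => (hw i).1
  have hg' : Measurable fun ω i => gI i ω := by fun_prop
  have := fun i => Measure.isProbabilityMeasure_map (μ := μ) (hg i).aemeasurable
  have := Measure.isProbabilityMeasure_map (μ := μ) hg'.aemeasurable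
  have := Measure.isProbabilityMeasure_map (μ := μ) hx.aemeasurable
  have hlaw := (indepFun_iff_map_prod_eq_prod_map_map hg'.aemeasurable hx.aemeasurable).mp hgx
  have h : ∀ᵐ z ∂((μ.map fun ω i => gI i ω).prod (μ.map x)), z.2 ≠ 0 →
      LinearIndependent ℂ (Fin.snoc z.1 z.2 : Fin (K + 1) → CVec L) := by
    refine ae_prod_of_ae_ae_swap ?_ (.of_forall fun y => ?_)
    · have h1 : MeasurableSet {z : (Fin K → CVec L) × CVec L | z.2 = 0} :=
        (isClosed_singleton.preimage continuous_snd).measurableSet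
      have h2 : MeasurableSet {z : (Fin K → CVec L) × CVec L |
          LinearIndependent ℂ (Fin.snoc z.1 z.2 : Fin (K + 1) → CVec L)} := by
        refine (isOpen_setOfPred_linearIndependent.preimage
          (f := fun z : (Fin K → CVec L) × CVec L => (Fin.snoc z.1 z.2 : Fin (K + 1) → CVec L))
          ?_).measurableSet
        fun_prop
      convert h1.union h2 using 1
      ext z
      simp only [ne_eq, Set.mem_ofPred_eq, Set.mem_union]
      tauto
    · by_cases hy : y = 0
      · simp [hy]
      · rw [map_pi_eq hg hind]
        filter_upwards [ae_linearIndependent_snoc hKL hc (fun i => IsCN.map_id (hw i)) hy] with g hg _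
        exact hg
  rw [← hlaw] at h
  exact ae_of_ae_map (by fun_prop) h

/-- Second moment of the zero-forcing directions of independent white channels. -/
lemma memLp_integral_norm_zfDir_sq (hKL : K < L) {gI : Fin K → Ω → CVec L}
    (hind : iIndepFun gI μ) {c : Fin K → ℝ} (hc : ∀ i, 0 < c i)
    (hw : ∀ i, IsWhite μ (gI i) (c i)) (k : Fin K) :
    MemLp (zfDir gI k) 2 μ ∧ ∫ ω, ‖zfDir gI k ω‖ ^ 2 ∂μ = (c k * (L - K : ℝ))⁻¹ := by
  have hg : ∀ i, Measurable (gI i) := fun i => (hw i).1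
  have hg' : Measurable fun ω i => gI i ω := by fun_prop
  have := fun i => Measure.isProbabilityMeasure_map (μ := μ) (hg i).aemeasurable
  have hLK : (0 : ℝ) < L - K := sub_pos.mpr (by exact_mod_cast hKL)
  have hpos : 0 ≤ (c k * (L - K : ℝ))⁻¹ := inv_nonneg.mpr (mul_nonneg (hc k).le hLK.le)
  have hzm : Measurable (zfDir gI k) := measurable_zfDir hg k
  have hl : ∫⁻ ω, ENNReal.ofReal (‖zfDir gI k ω‖ ^ 2) ∂μ
      = ENNReal.ofReal ((c k * (L - K : ℝ))⁻¹) := by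
    obtain ⟨n, rfl⟩ : ∃ n, K = n + 1 := ⟨K - 1, by have := k.pos; omega⟩
    have h := lintegral_norm_zfDir_sq hKL hc (fun i => IsCN.map_id (hw i)) k
    rw [← map_pi_eq hg hind, lintegral_map] at h
    · exact_mod_cast h
    · have := measurable_zfDir (L := L) (gI := fun i (f : Fin (n + 1) → CVec L) => f i)
        (fun i => measurable_pi_apply i) k
      fun_prop
    · exact hg'
  have hint : Integrable (fun ω => ‖zfDir gI k ω‖ ^ 2) μ := by
    refine ⟨by fun_prop, ?_⟩
    rw [hasFiniteIntegral_iff_ofReal (.of_forall fun ω => by positivity), hl]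
    exact ENNReal.ofReal_lt_top
  refine ⟨(memLp_two_iff_integrable_sq_norm (by fun_prop)).mpr hint, ?_⟩
  rw [integral_eq_lintegral_of_nonneg_ae (.of_forall fun ω => by positivity) (by fun_prop), hl,
    ENNReal.toReal_ofReal hpos]

omit [IsProbabilityMeasure μ] in
/-- Normalisation gives unit power to every direction with positive second moment. -/
lemma integral_norm_normFactor_smul_sq {v : Ω → CVec L} (hv : 0 < ∫ ω, ‖v ω‖ ^ 2 ∂μ) :
    ∫ ω, ‖((normFactor μ v : ℝ) : ℂ) • v ω‖ ^ 2 ∂μ = 1 := by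
  simp only [norm_smul, mul_pow, Complex.norm_real, Real.norm_eq_abs, sq_abs]
  rw [integral_const_mul, normFactor, ← Real.rpow_natCast, ← Real.rpow_mul hv.le]
  norm_num
  rw [Real.rpow_neg_one]
  exact inv_mul_cancel₀ hv.ne'

lemma normFactor_zfDir (hKL : K < L) {gI : Fin K → Ω → CVec L}
    (hind : iIndepFun gI μ) {c : Fin K → ℝ} (hc : ∀ i, 0 < c i)
    (hw : ∀ i, IsWhite μ (gI i) (c i)) (k : Fin K) :
    normFactor μ (zfDir gI k) = √(c k * (L - K : ℝ)) := by
  have hLK : (0 : ℝ) < L - K := sub_pos.mpr (by exact_mod_cast hKL)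
  have := mul_pos (hc k) hLK
  rw [normFactor, (memLp_integral_norm_zfDir_sq hKL hind hc hw k).2, Real.inv_rpow this.le,
    ← Real.rpow_neg this.le, neg_neg, Real.sqrt_eq_rpow]

lemma precoderI_unit_power (hKL : K < L) {gI : Fin K → Ω → CVec L}
    (hind : iIndepFun gI μ) {c : Fin K → ℝ} (hc : ∀ i, 0 < c i)
    (hw : ∀ i, IsWhite μ (gI i) (c i)) (k : Fin K) :
    MemLp (precoderI μ gI k) 2 μ ∧ ∫ ω, ‖precoderI μ gI k ω‖ ^ 2 ∂μ = 1 := by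
  have hLK : (0 : ℝ) < L - K := sub_pos.mpr (by exact_mod_cast hKL)
  have := mul_pos (hc k) hLK
  obtain ⟨h1, h2⟩ := memLp_integral_norm_zfDir_sq hKL hind hc hw k
  exact ⟨h1.const_smul ((normFactor μ _ : ℝ) : ℂ), integral_norm_normFactor_smul_sq (by rw [h2]; positivity)⟩

/-- The protective maximum ratio precoder is well defined: a nonzero random vector independent of
fewer than `L` independent white channels does not almost surely lie in their span. -/
lemma precoderE_unit_power (hKL : K < L) {gI : Fin K → Ω → CVec L}
    (hind : iIndepFun gI μ) {c : Fin K → ℝ} (hc : ∀ i, 0 < c i)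
    (hw : ∀ i, IsWhite μ (gI i) (c i)) {gE : Fin J → Ω → CVec L} (hE : ∀ j, Measurable (gE j))
    (j : Fin J) (hgE : IndepFun (fun ω i => gI i ω) (gE j) μ) (hE2 : MemLp (gE j) 2 μ)
    (hE0 : ¬ gE j =ᵐ[μ] 0) :
    MemLp (precoderE μ gI gE j) 2 μ ∧ ∫ ω, ‖precoderE μ gI gE j ω‖ ^ 2 ∂μ = 1 := by
  have hg : ∀ i, Measurable (gI i) := fun i => (hw i).1
  have hpm : Measurable (pmrtDir gI gE j) := measurable_pmrtDir hg hE j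
  have h1 : MemLp (pmrtDir gI gE j) 2 μ := by
    refine hE2.mono (by fun_prop) ?_
    filter_upwards [ae_linearIndependent_of_iIndepFun hKL hind hc hw] with ω hω
    exact norm_pmrtDir_le hω gE j
  refine ⟨h1.const_smul ((normFactor μ _ : ℝ) : ℂ), integral_norm_normFactor_smul_sq ?_⟩
  refine lt_of_le_of_ne (integral_nonneg fun ω => by positivity) fun h0 => hE0 ?_
  rw [eq_comm, integral_eq_zero_iff_of_nonneg (fun ω => by positivity)
    (h1.integrable_norm_pow (by norm_num))] at h0
  filter_upwards [h0, ae_linearIndependent_snoc_of_indepFun hKL hind hc hw (hE j) hgE] with ω h2 h3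
  by_contra h4
  refine pmrtDir_ne_zero (h3 h4) ?_
  simpa using h2

end Precoding

/-! ### Optimal estimates -/

section Estimation

variable {Ω : Type*} [MeasurableSpace Ω] {μ : Measure Ω} [IsProbabilityMeasure μ] {L : ℕ}

omit [IsProbabilityMeasure μ] in
lemma integrable_inner {f g : Ω → CVec L} (hf : MemLp f 2 μ) (hg : MemLp g 2 μ) :
    Integrable (fun ω => (inner ℂ (f ω) (g ω) : ℂ)) μ := by
  refine (hf.norm.integrable_mul hg.norm).mono' (hf.1.inner hg.1) (.of_forall fun ω => ?_)
  exact norm_inner_le_norm _ _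

/-- If the channel is a multiple of the observation plus an independent white error, then this
multiple is the only MMSE estimate. -/
lemma IsMMSE.ae_eq {g y gHat e : Ω → CVec L} {a : ℂ} {c : ℝ} (hc : 0 ≤ c)
    (h : IsMMSE μ g y gHat) (he : IsWhite μ e c) (hy : Measurable y) (hy2 : MemLp y 2 μ)
    (hg : ∀ ω, g ω = e ω + a • y ω) (hind : IndepFun e y μ) :
    gHat =ᵐ[μ] fun ω => a • y ω := by
  obtain ⟨f, -, hf, hf2, hgf, hopt⟩ := h
  have hem := he.1
  have he2 := he.memLp hc
  have hopt' := hopt (fun x => a • x) trivial (by fun_prop) (hy2.const_smul a)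
  set d : Ω → CVec L := fun ω => a • y ω - f (y ω) with hd
  have hdm : Measurable d := by fun_prop
  have hd2 : MemLp d 2 μ := (hy2.const_smul a).sub hf2
  have hind' : IndepFun e d μ := hind.comp (φ := id) (ψ := fun x => a • x - f x) measurable_id
    (by fun_prop)
  have hcross : ∫ ω, inner ℂ (e ω) (d ω) ∂μ = 0 :=
    IsCN.integral_odd_eq_zero he hdm hind' (F := fun x y => inner ℂ x y)
      (by unfold Function.uncurry; fun_prop) (fun x y => inner_neg_left x y)
  have hci : Integrable (fun ω => inner ℂ (e ω) (d ω)) μ :=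
    (he.inner_indep hc hdm hd2 hind').1.integrable (by norm_num)
  have hcre : ∫ ω, (inner ℂ (e ω) (d ω)).re ∂μ = 0 := by
    have := integral_re hci
    rw [hcross] at this
    simpa using this
  have i1 := he2.integrable_norm_pow (p := 2) (by norm_num)
  have i2 := hd2.integrable_norm_pow (p := 2) (by norm_num)
  have hexp : ∀ ω, ‖g ω - f (y ω)‖ ^ 2
      = ‖e ω‖ ^ 2 + 2 * (inner ℂ (e ω) (d ω)).re + ‖d ω‖ ^ 2 := by
    intro ω
    rw [hg, add_sub_assoc]
    exact norm_add_sq (𝕜 := ℂ) (e ω) (d ω)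
  have hexp' : ∀ ω, ‖g ω - a • y ω‖ ^ 2 = ‖e ω‖ ^ 2 := fun ω => by
    rw [hg, add_sub_cancel_right]
  simp only [hexp, hexp'] at hopt'
  have i3 : Integrable (fun ω => 2 * (inner ℂ (e ω) (d ω)).re) μ := hci.re.const_mul 2
  rw [integral_add (i1.fun_add i3) i2, integral_add i1 i3, integral_const_mul, hcre] at hopt'
  have h0 : ∫ ω, ‖d ω‖ ^ 2 ∂μ = 0 :=
    le_antisymm (by linarith) (integral_nonneg fun ω => by positivity)
  rw [integral_eq_zero_iff_of_nonneg (fun ω => by positivity) i2] at h0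
  filter_upwards [h0] with ω hω
  have : d ω = 0 := by simpa using hω
  rw [hgf, ← sub_eq_zero.mp this]

omit [IsProbabilityMeasure μ] in
/-- An optimal estimate from an observation which is correlated with the channel does not vanish
almost surely: a small multiple of the observation beats the zero estimate. -/
lemma IsOptimalEstimate.not_ae_eq_zero {F : Set (CVec L → CVec L)} {g y gHat : Ω → CVec L}
    (h : IsOptimalEstimate μ F g y gHat) (hF : ∀ t : ℝ, (fun x => (t : ℂ) • x) ∈ F)
    (hg : MemLp g 2 μ) (hy : MemLp y 2 μ)
    (hcorr : ∫ ω, (inner ℂ (g ω) (y ω)).re ∂μ ≠ 0) : ¬ gHat =ᵐ[μ] 0 := by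
  intro h0
  obtain ⟨f, -, hf, hf2, hgf, hopt⟩ := h
  set r := ∫ ω, (inner ℂ (g ω) (y ω)).re ∂μ with hr
  set B := ∫ ω, ‖y ω‖ ^ 2 ∂μ with hB
  have hB0 : 0 ≤ B := integral_nonneg fun ω => by positivity
  set t : ℝ := r / (B + 1) with ht
  have hopt' := hopt (fun x => (t : ℂ) • x) (hF t) (by fun_prop) (hy.const_smul (t : ℂ))
  have i1 := hg.integrable_norm_pow (p := 2) (by norm_num)
  have i2 := (hy.integrable_norm_pow (p := 2) (by norm_num)).const_mul (t ^ 2)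
  have i3 : Integrable (fun ω => 2 * t * (inner ℂ (g ω) (y ω)).re) μ :=
    (integrable_inner hg hy).re.const_mul (2 * t)
  have e1 : ∫ ω, ‖g ω - f (y ω)‖ ^ 2 ∂μ = ∫ ω, ‖g ω‖ ^ 2 ∂μ := by
    refine integral_congr_ae ?_
    filter_upwards [h0] with ω hω
    rw [← hgf, hω]
    simp
  have e2 : ∀ ω, ‖g ω - (t : ℂ) • y ω‖ ^ 2
      = ‖g ω‖ ^ 2 - 2 * t * (inner ℂ (g ω) (y ω)).re + t ^ 2 * ‖y ω‖ ^ 2 := by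
    intro ω
    rw [norm_sub_sq (𝕜 := ℂ), inner_smul_right, norm_smul, mul_pow]
    simp
    ring
  simp only [e1, e2] at hopt'
  rw [integral_add (i1.sub' i3) i2, integral_sub i1 i3, integral_const_mul, integral_const_mul,
    ← hr, ← hB] at hopt'
  have h1 : 2 * t * r ≤ t ^ 2 * B := by linarith
  have h2 : r = t * (B + 1) := by rw [ht]; field_simp
  have ht0 : t ≠ 0 := by
    intro h; rw [h, zero_mul] at h2; exact hcorr h2
  have : 0 < t ^ 2 := by positivity
  rw [h2] at h1
  nlinarith

omit [IsProbabilityMeasure μ] in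
lemma IsOptimalEstimate.exists_measurable {F : Set (CVec L → CVec L)} {g y gHat : Ω → CVec L}
    (h : IsOptimalEstimate μ F g y gHat) :
    ∃ f : CVec L → CVec L, Measurable f ∧ (∀ ω, gHat ω = f (y ω)) ∧ MemLp gHat 2 μ := by
  obtain ⟨f, -, hf, hf2, hgf, -⟩ := h
  exact ⟨f, hf, hgf, by rwa [funext hgf]⟩

end Estimation

/-! ### Independence of groups of variables -/

section Independence

variable {Ω : Type*} [MeasurableSpace Ω] {μ : Measure Ω}

/-- If `X` is independent of `Y` and the pair `(X, Y)` of `Z`, then `X` is independent of the pair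
`(Y, Z)`. -/
lemma indepFun_prodMk_assoc [IsProbabilityMeasure μ] {α β γ : Type*} [MeasurableSpace α]
    [MeasurableSpace β] [MeasurableSpace γ] {X : Ω → α} {Y : Ω → β} {Z : Ω → γ}
    (hX : Measurable X) (hY : Measurable Y) (hZ : Measurable Z) (hXY : IndepFun X Y μ)
    (hXYZ : IndepFun (fun ω => (X ω, Y ω)) Z μ) : IndepFun X (fun ω => (Y ω, Z ω)) μ := by
  have := Measure.isProbabilityMeasure_map (μ := μ) hX.aemeasurable
  have := Measure.isProbabilityMeasure_map (μ := μ) hY.aemeasurable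
  have := Measure.isProbabilityMeasure_map (μ := μ) hZ.aemeasurable
  have hYZ : IndepFun Y Z μ := hXYZ.comp measurable_snd measurable_id
  have h1 := (indepFun_iff_map_prod_eq_prod_map_map (hX.prodMk hY).aemeasurable
    hZ.aemeasurable).mp hXYZ
  rw [(indepFun_iff_map_prod_eq_prod_map_map hX.aemeasurable hY.aemeasurable).mp hXY] at h1
  rw [indepFun_iff_map_prod_eq_prod_map_map hX.aemeasurable (hY.prodMk hZ).aemeasurable,
    (indepFun_iff_map_prod_eq_prod_map_map hY.aemeasurable hZ.aemeasurable).mp hYZ,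
    ← Measure.prodAssoc_prod, ← h1, Measure.map_map (by fun_prop) (by fun_prop)]
  rfl

/-- Functions of disjoint groups of independent variables are independent. -/
lemma iIndepFun.indepFun_of_measurable_iSup {ι : Type*} {β : ι → Type*}
    [m : ∀ i, MeasurableSpace (β i)] {X : ∀ i, Ω → β i} (hX : iIndepFun X μ)
    (hm : ∀ i, Measurable (X i)) {S T : Set ι} (hST : Disjoint S T) {α γ : Type*}
    [MeasurableSpace α] [MeasurableSpace γ] {f : Ω → α} {g : Ω → γ}
    (hf : Measurable[⨆ i ∈ S, (m i).comap (X i)] f)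
    (hg : Measurable[⨆ i ∈ T, (m i).comap (X i)] g) : IndepFun f g μ := by
  rw [IndepFun_iff_Indep]
  exact indep_of_indep_of_le_left (indep_of_indep_of_le_right
    (indep_iSup_of_disjoint (fun i => (hm i).comap_le) hX hST) hg.comap_le) hf.comap_le

omit [MeasurableSpace Ω] in
lemma measurable_iSup_comap {ι : Type*} {β : ι → Type*}
    [m : ∀ i, MeasurableSpace (β i)] (X : ∀ i, Ω → β i) {S : Set ι} {i : ι} (hi : i ∈ S) :
    Measurable[⨆ i ∈ S, (m i).comap (X i)] (X i) :=
  (comap_measurable (X i)).mono (le_biSup (fun i => (m i).comap (X i)) hi) le_rfl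

end Independence

/-! ### Sources of the fading model -/

section Model

variable {M K J L N τ : ℕ} {Ω : Type*} [MeasurableSpace Ω] {μ : Measure Ω}

lemma Network.cov_posSemidef (P : Network M K J L N τ) (s : Source M K J L τ) :
    (P.cov s).PosSemidef := by
  cases s with
  | iu m k => exact posSemidef_smul_one (P.betaI_pos m k).le
  | eu m j => exact posSemidef_smul_one (P.betaE_pos m j).le
  | ap m l => exact P.covAP_psd m
  | ris j => exact P.covEU_psd j
  | noise m t => exact Matrix.PosSemidef.one

lemma Network.IsRayleigh.measurable {P : Network M K J L N τ} {X : Fading M K J L N τ Ω}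
    (hX : P.IsRayleigh μ X) (s : Source M K J L τ) : Measurable (X s) := (hX.1 s).1

/-- The channels to the information users and the training noise, all of which are white vectors of
length `L`. -/
def whiteSource (X : Fading M K J L N τ Ω) :
    (Fin M × Fin K) ⊕ (Fin M × Fin τ) → Ω → CVec L
  | .inl s => X (.iu s.1 s.2)
  | .inr s => X (.noise s.1 s.2)

/-- The variances of the white sources. -/
def Network.whiteVar (P : Network M K J L N τ) : (Fin M × Fin K) ⊕ (Fin M × Fin τ) → ℝ
  | .inl s => P.betaI s.1 s.2
  | .inr _ => 1

/-- The values of the channels from the APs to the RIS and from the RIS to the energy users. -/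
abbrev RisSpace (M J L N : ℕ) := (Fin M → Fin L → CVec N) × (Fin J → CVec N)

/-- The values of all the channels that make up the channels of the energy users. -/
abbrev EuSpace (M J L N : ℕ) := (Fin M → Fin J → CVec L) × RisSpace M J L N

/-- The channels from and to the RIS. -/
def risSource (X : Fading M K J L N τ Ω) (ω : Ω) : RisSpace M J L N :=
  (fun m l => X (.ap m l) ω, fun j => X (.ris j) ω)

/-- All the channels that make up the channels of the energy users. -/
def euSource (X : Fading M K J L N τ Ω) (ω : Ω) : EuSpace M J L N :=
  (fun m j => X (.eu m j) ω, risSource X ω)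

/-- The cascaded link `H_mᴴ Θ z_j` through the RIS as a function of the values of the channels. -/
noncomputable def Network.cascade (P : Network M K J L N τ) (m : Fin M) (j : Fin J)
    (r : RisSpace M J L N) : CVec L :=
  WithLp.toLp 2 ((Matrix.of fun n l => r.1 m l n : Matrix (Fin N) (Fin L) ℂ)ᴴ *ᵥ
    (P.Theta *ᵥ (r.2 j).ofLp))

omit [MeasurableSpace Ω] in
lemma Network.chanE_eq (P : Network M K J L N τ) (X : Fading M K J L N τ Ω) (m : Fin M)
    (j : Fin J) (ω : Ω) :
    P.chanE X m j ω = (euSource X ω).1 m j + P.cascade m j (euSource X ω).2 := rfl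

lemma Network.continuous_cascade (P : Network M K J L N τ) (m : Fin M) (j : Fin J) :
    Continuous (P.cascade m j) := by
  unfold cascade
  refine (PiLp.continuous_toLp 2 _).comp (Continuous.matrix_mulVec ?_ ?_)
  · refine Continuous.matrix_conjTranspose ?_
    fun_prop
  · refine Continuous.matrix_mulVec continuous_const ?_
    fun_prop

lemma Network.cascade_apply (P : Network M K J L N τ) (m : Fin M) (j : Fin J)
    (r : RisSpace M J L N) (l : Fin L) :
    P.cascade m j r l = inner ℂ (r.1 m l) (WithLp.toLp 2 (P.Theta *ᵥ (r.2 j).ofLp)) := by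
  simp [cascade, Matrix.mulVec, dotProduct, PiLp.inner_apply, mul_comm, -Matrix.mulVec_mulVec]

section Rayleigh

variable {P : Network M K J L N τ} {X : Fading M K J L N τ Ω}

lemma Network.IsRayleigh.isWhite_whiteSource (hX : P.IsRayleigh μ X)
    (s : (Fin M × Fin K) ⊕ (Fin M × Fin τ)) : IsWhite μ (whiteSource X s) (P.whiteVar s) := by
  cases s with
  | inl s => exact hX.1 (.iu s.1 s.2)
  | inr s =>
    have := hX.1 (.noise s.1 s.2)
    simp only [IsWhite, whiteVar, Complex.ofReal_one, one_smul]
    exact this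

lemma Network.IsRayleigh.iIndepFun_whiteSource (hX : P.IsRayleigh μ X) :
    iIndepFun (whiteSource X) μ := by
  let f : (Fin M × Fin K) ⊕ (Fin M × Fin τ) → Source M K J L τ :=
    Sum.elim (fun s => .iu s.1 s.2) (fun s => .noise s.1 s.2)
  have hf : Function.Injective f := by
    rintro (⟨m, k⟩ | ⟨m, t⟩) (⟨m', k'⟩ | ⟨m', t'⟩) h <;> simp_all [f]
  have h := hX.2.precomp hf
  let c : ∀ s, CVec ((f s).dim N) → CVec L := fun s =>
    match s with
    | .inl _ => fun x => x
    | .inr _ => fun x => x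
  have hc : ∀ s, Measurable (c s) := by
    rintro (s | s) <;> exact measurable_id
  convert h.comp c hc using 1
  funext s
  cases s <;> rfl

lemma Network.IsRayleigh.indepFun_whiteSource_euSource (hX : P.IsRayleigh μ X) :
    IndepFun (fun ω s => whiteSource X s ω) (euSource X) μ := by
  refine iIndepFun.indepFun_of_measurable_iSup hX.2 hX.measurable
    (S := {s | (∃ m k, s = .iu m k) ∨ ∃ m t, s = .noise m t})
    (T := {s | (∃ m j, s = .eu m j) ∨ (∃ m l, s = .ap m l) ∨ ∃ j, s = .ris j}) ?_ ?_ ?_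
  · rw [Set.disjoint_left]
    rintro s (⟨m, k, rfl⟩ | ⟨m, t, rfl⟩) <;> simp
  · refine @measurable_pi_iff _ _ _ (_) _ _ |>.mpr fun s => ?_
    cases s with
    | inl s => exact measurable_iSup_comap X (i := .iu s.1 s.2) (by simp)
    | inr s => exact measurable_iSup_comap X (i := .noise s.1 s.2) (by simp)
  · refine @Measurable.prodMk _ _ _ _ _ (_) _ _ ?_ (@Measurable.prodMk _ _ _ _ _ (_) _ _ ?_ ?_)
    · refine @measurable_pi_iff _ _ _ (_) _ _ |>.mpr fun m =>
        @measurable_pi_iff _ _ _ (_) _ _ |>.mpr fun j => ?_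
      exact measurable_iSup_comap X (i := .eu m j) (by simp)
    · refine @measurable_pi_iff _ _ _ (_) _ _ |>.mpr fun m =>
        @measurable_pi_iff _ _ _ (_) _ _ |>.mpr fun l => ?_
      exact measurable_iSup_comap X (i := .ap m l) (by simp)
    · refine @measurable_pi_iff _ _ _ (_) _ _ |>.mpr fun j => ?_
      exact measurable_iSup_comap X (i := .ris j) (by simp)

lemma Network.IsRayleigh.measurable_risSource (hX : P.IsRayleigh μ X) :
    Measurable (risSource X) := by
  refine Measurable.prodMk (measurable_pi_iff.mpr fun m => measurable_pi_iff.mpr fun l => ?_)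
    (measurable_pi_iff.mpr fun j => ?_)
  · exact hX.measurable (.ap m l)
  · exact hX.measurable (.ris j)

lemma Network.IsRayleigh.measurable_euSource (hX : P.IsRayleigh μ X) :
    Measurable (euSource X) := by
  refine Measurable.prodMk (measurable_pi_iff.mpr fun m => measurable_pi_iff.mpr fun j => ?_)
    hX.measurable_risSource
  exact hX.measurable (.eu m j)

lemma Network.IsRayleigh.indepFun_eu_risSource (hX : P.IsRayleigh μ X) (m : Fin M) (j : Fin J) :
    IndepFun (fun ω => (euSource X ω).1 m j) (risSource X) μ := by
  refine iIndepFun.indepFun_of_measurable_iSup hX.2 hX.measurable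
    (S := {s | s = .eu m j}) (T := {s | (∃ m l, s = .ap m l) ∨ ∃ j, s = .ris j}) ?_ ?_ ?_
  · rw [Set.disjoint_left]
    rintro s rfl
    simp
  · exact measurable_iSup_comap X (i := .eu m j) (by simp)
  · refine (@Measurable.prodMk _ _ _ _ _ (_) _ _ ?_ ?_)
    · refine @measurable_pi_iff _ _ _ (_) _ _ |>.mpr fun m =>
        @measurable_pi_iff _ _ _ (_) _ _ |>.mpr fun l => ?_
      exact measurable_iSup_comap X (i := .ap m l) (by simp)
    · refine @measurable_pi_iff _ _ _ (_) _ _ |>.mpr fun j => ?_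
      exact measurable_iSup_comap X (i := .ris j) (by simp)

variable [IsProbabilityMeasure μ]

lemma Network.IsRayleigh.memLp (hX : P.IsRayleigh μ X) (s : Source M K J L τ) :
    MemLp (X s) 2 μ := IsCN.memLp (hX.1 s) (P.cov_posSemidef s)

/-- The cascaded links are square integrable although they are quadratic in the Gaussian sources:
their two factors are independent. -/
lemma Network.IsRayleigh.memLp_cascade (hX : P.IsRayleigh μ X) (m : Fin M) (j : Fin J) :
    MemLp (fun ω => P.cascade m j (risSource X ω)) 2 μ := by
  refine MemLp.of_eval_piLp fun l => ?_
  set a : Ω → CVec N := X (.ap m l) with ha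
  set T : CVec N →L[ℂ] CVec N := LinearMap.toContinuousLinearMap
    (Matrix.toEuclideanLin P.Theta) with hT
  set b : Ω → CVec N := fun ω => T ((show Ω → CVec N from X (.ris j)) ω) with hb
  have ha2 : MemLp a 2 μ := hX.memLp (.ap m l)
  have hb2 : MemLp b 2 μ := T.comp_memLp' (hX.memLp (.ris j))
  have hab : IndepFun a b μ := by
    have h : IndepFun (X (.ap m l)) (X (.ris j)) μ := hX.2.indepFun (by simp)
    exact h.comp (φ := id) (ψ := fun x : CVec N => T x) measurable_id T.continuous.measurable
  have hint : Integrable (fun ω => ‖a ω‖ ^ 2 * ‖b ω‖ ^ 2) μ := by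
    refine IndepFun.integrable_mul ?_ (ha2.integrable_norm_pow (by norm_num))
      (hb2.integrable_norm_pow (by norm_num))
    exact hab.comp (φ := fun x => ‖x‖ ^ 2) (ψ := fun x => ‖x‖ ^ 2) (by fun_prop) (by fun_prop)
  have he : ∀ ω, P.cascade m j (risSource X ω) l = inner ℂ (a ω) (b ω) := fun ω =>
    P.cascade_apply m j (risSource X ω) l
  simp only [he]
  have hms : AEStronglyMeasurable (fun ω => (inner ℂ (a ω) (b ω) : ℂ)) μ := ha2.1.inner hb2.1
  refine (memLp_two_iff_integrable_sq_norm hms).mpr (hint.mono' (by fun_prop)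
    (.of_forall fun ω => ?_))
  rw [Real.norm_eq_abs, abs_of_nonneg (by positivity), ← mul_pow]
  exact pow_le_pow_left₀ (norm_nonneg _) (norm_inner_le_norm _ _) 2

lemma Network.IsRayleigh.memLp_chanE (hX : P.IsRayleigh μ X) (m : Fin M) (j : Fin J) :
    MemLp (P.chanE X m j) 2 μ :=
  MemLp.add (hX.memLp (.eu m j)) (hX.memLp_cascade m j)

/-- The channels of the energy users do not vanish almost surely: the direct link is nondegenerate
and independent of the cascaded link. -/
lemma Network.IsRayleigh.integral_norm_chanE_sq_pos (hX : P.IsRayleigh μ X) (hL : 0 < L)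
    (m : Fin M) (j : Fin J) : 0 < ∫ ω, ‖P.chanE X m j ω‖ ^ 2 ∂μ := by
  refine lt_of_le_of_ne (integral_nonneg fun ω => by positivity) fun h0 => ?_
  rw [eq_comm, integral_eq_zero_iff_of_nonneg (fun ω => by positivity)
    ((hX.memLp_chanE m j).integrable_norm_pow (by norm_num))] at h0
  set h : Ω → CVec L := X (.eu m j) with hh
  have hw : IsWhite μ h (P.betaE m j) := hX.1 (.eu m j)
  have h1 : ∫ ω, inner ℂ (h ω) (P.cascade m j (risSource X ω)) ∂μ = 0 :=
    IsCN.integral_odd_eq_zero hw hX.measurable_risSource (hX.indepFun_eu_risSource m j)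
      (F := fun x r => inner ℂ x (P.cascade m j r))
      (by
        have := (P.continuous_cascade m j).measurable
        unfold Function.uncurry
        fun_prop)
      (fun x y => inner_neg_left _ _)
  have h2 : ∫ ω, ((‖h ω‖ ^ 2 : ℝ) : ℂ) ∂μ = 0 := by
    rw [← neg_eq_zero, ← integral_neg, ← h1]
    refine integral_congr_ae ?_
    filter_upwards [h0] with ω hω
    have h3 : P.chanE X m j ω = 0 := by simpa using hω
    have h4 : P.cascade m j (risSource X ω) = -h ω := by
      rw [P.chanE_eq] at h3
      exact eq_neg_of_add_eq_zero_right h3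
    rw [h4, inner_neg_right, inner_self_eq_norm_sq_to_K]
    push_cast; rfl
  rw [integral_complex_ofReal, Complex.ofReal_eq_zero,
    integral_eq_zero_iff_of_nonneg (fun ω => by positivity)
      ((hw.memLp (P.betaE_pos m j).le).integrable_norm_pow (by norm_num))] at h2
  have hv : EuclideanSpace.single (⟨0, hL⟩ : Fin L) (1 : ℂ) ≠ 0 := by
    intro h; simpa using congrArg norm h
  have h5 : ∀ᵐ ω ∂μ, False := by
    filter_upwards [h2, hw.ae_inner_ne_zero (P.betaE_pos m j) hv] with ω h6 h7
    have : h ω = 0 := by simpa using h6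
    exact h7 (by rw [this, inner_zero_right])
  obtain ⟨_, h6⟩ := h5.exists
  exact h6

end Rayleigh
end Model

/-! ### Training variables -/

section Training

variable {M K J L N τ : ℕ} {Ω : Type*}

/-- Large-scale fading of the part of a user's channel which is carried by a white source: zero for
energy users, whose channels are kept apart from the white sources. -/
def Network.betaU (P : Network M K J L N τ) (m : Fin M) : Fin K ⊕ Fin J → ℝ
  | .inl k => P.betaI m k
  | .inr _ => 0

lemma Network.betaU_nonneg (P : Network M K J L N τ) (m : Fin M) (u : Fin K ⊕ Fin J) :
    0 ≤ P.betaU m u := by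
  cases u with
  | inl k => exact (P.betaI_pos m k).le
  | inr j => exact le_rfl

/-- Amplitude `√(τ ρ_u)` of the channel in the projected training signal. -/
noncomputable def Network.amp (P : Network M K J L N τ) : ℝ := √(τ * P.rhoU)

lemma Network.amp_sq (P : Network M K J L N τ) : P.amp ^ 2 = τ * P.rhoU :=
  Real.sq_sqrt (mul_nonneg (Nat.cast_nonneg _) P.rhoU_pos.le)

/-- Coefficient of the linear MMSE estimate of the white part of a channel from the projected
training signal. -/
noncomputable def Network.wiener (P : Network M K J L N τ) (m : Fin M) (u : Fin K ⊕ Fin J) : ℝ :=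
  P.amp * P.betaU m u / (P.amp ^ 2 * P.betaU m u + 1)

/-- Index of the variables obtained from the white sources at an AP for a user: with `true` the
estimation error, with `false` the projected training signal (restricted to the projected noise for
energy users). -/
abbrev TrainIdx (M K J : ℕ) := Fin M × (Fin K ⊕ Fin J) × Bool

/-- Coefficient of the channel in a training variable. -/
noncomputable def Network.chanCoef (P : Network M K J L N τ) : TrainIdx M K J → ℝ
  | (m, u, true) => 1 - P.wiener m u * P.amp
  | (_, _, false) => P.amp

/-- Coefficient of the projected noise in a training variable. -/
noncomputable def Network.noiseCoef (P : Network M K J L N τ) : TrainIdx M K J → ℝ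
  | (m, u, true) => -P.wiener m u
  | (_, _, false) => 1

/-- Variance of a training variable. -/
noncomputable def Network.trainVar (P : Network M K J L N τ) : TrainIdx M K J → ℝ
  | (m, u, true) => P.betaU m u / (P.amp ^ 2 * P.betaU m u + 1)
  | (m, u, false) => P.amp ^ 2 * P.betaU m u + 1

lemma Network.trainVar_nonneg (P : Network M K J L N τ) (i : TrainIdx M K J) :
    0 ≤ P.trainVar i := by
  obtain ⟨m, u, b⟩ := i
  have := P.betaU_nonneg m u
  cases b <;> simp only [trainVar] <;> positivity

/-- Coefficients of the training variables in terms of the white sources. -/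
noncomputable def Network.trainCoef (P : Network M K J L N τ) (i : TrainIdx M K J) :
    (Fin M × Fin K) ⊕ (Fin M × Fin τ) → ℂ
  | .inl s => if i.1 = s.1 ∧ i.2.1 = .inl s.2 then (P.chanCoef i : ℂ) else 0
  | .inr s => if i.1 = s.1 then (P.noiseCoef i : ℂ) * P.pilot i.2.1 s.2 else 0

/-- The training variables. -/
noncomputable def Network.train (P : Network M K J L N τ) (X : Fading M K J L N τ Ω)
    (i : TrainIdx M K J) (ω : Ω) : CVec L :=
  ∑ s, P.trainCoef i s • whiteSource X s ω

lemma Network.pilot_sum (P : Network M K J L N τ) (u v : Fin K ⊕ Fin J) :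
    ∑ t, P.pilot u t * star (P.pilot v t) = if u = v then 1 else 0 := by
  have h := orthonormal_iff_ite.mp P.pilot_orthonormal v u
  simp only [PiLp.inner_apply, RCLike.inner_apply] at h
  simp only [Complex.star_def, h, eq_comm]

/-- The rows of the coefficients of the training variables are orthogonal: this is the defining
property of the linear MMSE estimate, together with the orthogonality of the pilots. -/
lemma Network.trainCoef_orthogonal (P : Network M K J L N τ) (i i' : TrainIdx M K J) :
    ∑ s, (P.whiteVar s : ℂ) * (P.trainCoef i s * star (P.trainCoef i' s))
      = if i = i' then (P.trainVar i : ℂ) else 0 := by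
  have hchan : ∑ s : Fin M × Fin K, (P.whiteVar (.inl s) : ℂ) *
      (P.trainCoef i (.inl s) * star (P.trainCoef i' (.inl s)))
        = if i.1 = i'.1 ∧ i.2.1 = i'.2.1 then
          ((P.betaU i.1 i.2.1 * (P.chanCoef i * P.chanCoef i') : ℝ) : ℂ) else 0 := by
    obtain ⟨m, u, b⟩ := i
    obtain ⟨m', u', b'⟩ := i'
    simp only [trainCoef, whiteVar]
    cases u with
    | inr j => simp [betaU]
    | inl k =>
      rw [Finset.sum_eq_single (m, k)]
      · by_cases h : m' = m ∧ u' = .inl k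
        · simp [h, betaU]
        · have h' : ¬ (m = m' ∧ .inl k = u') := fun hh => h ⟨hh.1.symm, hh.2.symm⟩
          simp [h, h']
      · rintro ⟨m'', k''⟩ - hne
        have : ¬ (m = m'' ∧ (Sum.inl k : Fin K ⊕ Fin J) = .inl k'') := by
          rintro ⟨rfl, h⟩
          exact hne (by rw [Sum.inl_injective h])
        rw [if_neg this, zero_mul, mul_zero]
      · simp
  have hnoise : ∑ s : Fin M × Fin τ, (P.whiteVar (.inr s) : ℂ) *
      (P.trainCoef i (.inr s) * star (P.trainCoef i' (.inr s)))
        = if i.1 = i'.1 ∧ i.2.1 = i'.2.1 then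
          ((P.noiseCoef i * P.noiseCoef i' : ℝ) : ℂ) else 0 := by
    simp only [trainCoef, whiteVar, Complex.ofReal_one, one_mul, Fintype.sum_prod_type]
    rw [Finset.sum_eq_single i.1]
    · by_cases h : i'.1 = i.1
      · simp only [h, if_true, true_and, star_mul', Complex.star_def, Complex.conj_ofReal]
        have hp := P.pilot_sum i.2.1 i'.2.1
        calc _ = ((P.noiseCoef i * P.noiseCoef i' : ℝ) : ℂ) *
              ∑ t, P.pilot i.2.1 t * star (P.pilot i'.2.1 t) := by
              rw [Finset.mul_sum]
              refine Finset.sum_congr rfl fun t _ => ?_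
              push_cast
              simp only [Complex.star_def]
              ring
          _ = _ := by rw [hp]; split_ifs <;> simp
      · have h' : ¬ (i.1 = i'.1 ∧ i.2.1 = i'.2.1) := fun hh => h hh.1.symm
        simp [h, h']
    · intro m _ hm
      simp [hm.symm]
    · simp
  rw [Fintype.sum_sum_type, hchan, hnoise]
  by_cases h : i.1 = i'.1 ∧ i.2.1 = i'.2.1
  · obtain ⟨m, u, b⟩ := i
    obtain ⟨m', u', b'⟩ := i'
    obtain ⟨rfl, rfl⟩ := h
    have h0 := P.betaU_nonneg m u
    have h1 : P.amp ^ 2 * P.betaU m u + 1 ≠ 0 := by positivity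
    simp only [and_self, if_true, ← Complex.ofReal_add]
    cases b <;> cases b' <;> simp only [Prod.mk.injEq, if_true, reduceCtorEq, if_false,
      chanCoef, noiseCoef, trainVar, wiener, and_false, ← Complex.ofReal_zero] <;>
      refine congrArg Complex.ofReal ?_ <;> field_simp <;> ring
  · have h' : i ≠ i' := fun hh => h (by rw [hh]; exact ⟨rfl, rfl⟩)
    simp [h, h']

lemma Network.train_eq (P : Network M K J L N τ) (X : Fading M K J L N τ Ω) (m : Fin M)
    (u : Fin K ⊕ Fin J) (b : Bool) (ω : Ω) :
    P.train X (m, u, b) ω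
      = (P.chanCoef (m, u, b) : ℂ) • Sum.elim (fun k => chanI X m k ω) (fun _ => 0) u
        + (P.noiseCoef (m, u, b) : ℂ) •
          ∑ t, P.pilot u t • whiteSource X (.inr (m, t)) ω := by
  rw [train, Fintype.sum_sum_type]
  congr 1
  · simp only [trainCoef]
    cases u with
    | inr j => simp
    | inl k =>
      rw [Finset.sum_eq_single (m, k)]
      · rw [if_pos ⟨rfl, rfl⟩]; rfl
      · rintro ⟨m', k'⟩ - hne
        have : ¬ (m = m' ∧ (Sum.inl k : Fin K ⊕ Fin J) = .inl k') := by
          rintro ⟨rfl, h⟩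
          exact hne (by rw [Sum.inl_injective h])
        rw [if_neg this, zero_smul]
      · simp
  · simp only [trainCoef, Fintype.sum_prod_type, Finset.smul_sum]
    rw [Finset.sum_eq_single m]
    · exact Finset.sum_congr rfl fun t _ => by rw [if_pos rfl, mul_smul]
    · intro m' _ hm
      simp [hm.symm]
    · simp

lemma Network.observation_eq (P : Network M K J L N τ) (X : Fading M K J L N τ Ω) (m : Fin M)
    (u : Fin K ⊕ Fin J) (ω : Ω) :
    P.observation X m u ω = (P.amp : ℂ) • P.chan X m u ω
      + ∑ t, P.pilot u t • whiteSource X (.inr (m, t)) ω := by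
  ext l
  simp only [observation, received, Matrix.mulVec, dotProduct, Matrix.of_apply, add_mul,
    Finset.sum_add_distrib, PiLp.add_apply, PiLp.smul_apply, smul_eq_mul]
  congr 1
  · have h : ∀ t, (P.amp : ℂ) * (∑ v, P.chan X m v ω l * star (P.pilot v t)) * P.pilot u t
        = ∑ v, (P.amp : ℂ) * P.chan X m v ω l * (P.pilot u t * star (P.pilot v t)) := by
      intro t
      rw [Finset.mul_sum, Finset.sum_mul]
      exact Finset.sum_congr rfl fun v _ => by ring
    calc _ = ∑ t, (P.amp : ℂ) * (∑ v, P.chan X m v ω l * star (P.pilot v t)) * P.pilot u t := rfl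
      _ = (P.amp : ℂ) * P.chan X m u ω l := by
        simp only [h]
        rw [Finset.sum_comm]
        simp only [← Finset.mul_sum, P.pilot_sum]
        simp
  · rw [WithLp.ofLp_sum, Finset.sum_apply]
    exact Finset.sum_congr rfl fun t _ => mul_comm _ _

lemma Network.observation_inl (P : Network M K J L N τ) (X : Fading M K J L N τ Ω) (m : Fin M)
    (k : Fin K) (ω : Ω) : P.observation X m (.inl k) ω = P.train X (m, .inl k, false) ω := by
  rw [P.observation_eq, P.train_eq]
  simp [chanCoef, noiseCoef, chan]

lemma Network.observation_inr (P : Network M K J L N τ) (X : Fading M K J L N τ Ω) (m : Fin M)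
    (j : Fin J) (ω : Ω) : P.observation X m (.inr j) ω
      = (P.amp : ℂ) • P.chanE X m j ω + P.train X (m, .inr j, false) ω := by
  rw [P.observation_eq, P.train_eq]
  simp [noiseCoef, chan]

lemma Network.chanI_eq (P : Network M K J L N τ) (X : Fading M K J L N τ Ω) (m : Fin M)
    (k : Fin K) (ω : Ω) : chanI X m k ω
      = P.train X (m, .inl k, true) ω
        + (P.wiener m (.inl k) : ℂ) • P.observation X m (.inl k) ω := by
  rw [P.observation_inl, P.train_eq, P.train_eq]
  simp only [chanCoef, noiseCoef, Sum.elim_inl, smul_add, smul_smul]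
  push_cast
  module

lemma Network.trainVar_error (P : Network M K J L N τ) (m : Fin M) (k : Fin K) :
    P.trainVar (m, .inl k, true) = P.betaI m k - P.gammaI m k := by
  have h0 := (P.betaI_pos m k)
  have h1 : P.amp ^ 2 * P.betaI m k + 1 ≠ 0 := by positivity
  simp only [trainVar, gammaI, betaU, ← P.amp_sq]
  field_simp
  ring

lemma Network.wiener_sq_mul_trainVar (P : Network M K J L N τ) (m : Fin M) (k : Fin K) :
    P.wiener m (.inl k) ^ 2 * P.trainVar (m, .inl k, false) = P.gammaI m k := by
  have h0 := (P.betaI_pos m k)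
  have h1 : P.amp ^ 2 * P.betaI m k + 1 ≠ 0 := by positivity
  simp only [trainVar, gammaI, betaU, wiener, ← P.amp_sq]
  field_simp

section Rayleigh

variable {P : Network M K J L N τ} {X : Fading M K J L N τ Ω} [MeasurableSpace Ω]
  {μ : Measure Ω} [IsProbabilityMeasure μ]

lemma Network.IsRayleigh.iIndepFun_train (hX : P.IsRayleigh μ X) : iIndepFun (P.train X) μ :=
  (linear_images_white hX.iIndepFun_whiteSource hX.isWhite_whiteSource
    P.trainCoef_orthogonal).1

lemma Network.IsRayleigh.isWhite_train (hX : P.IsRayleigh μ X) (i : TrainIdx M K J) :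
    IsWhite μ (P.train X i) (P.trainVar i) :=
  (linear_images_white hX.iIndepFun_whiteSource hX.isWhite_whiteSource
    P.trainCoef_orthogonal).2 i

omit [IsProbabilityMeasure μ] in
lemma Network.IsRayleigh.indepFun_train_euSource (hX : P.IsRayleigh μ X) :
    IndepFun (fun ω i => P.train X i ω) (euSource X) μ := by
  have hφ : Measurable fun (v : (Fin M × Fin K) ⊕ (Fin M × Fin τ) → CVec L)
      (i : TrainIdx M K J) => ∑ s, P.trainCoef i s • v s := by fun_prop
  exact hX.indepFun_whiteSource_euSource.comp hφ measurable_id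

/-- Disjoint groups of training variables are independent, also when one of the groups is joined
with all the sources of the channels of the energy users. -/
lemma Network.IsRayleigh.indepFun_train_finset (hX : P.IsRayleigh μ X)
    {S T : Finset (TrainIdx M K J)} (hST : Disjoint S T) :
    IndepFun (fun ω (i : S) => P.train X i ω)
      (fun ω => ((fun (i : T) => P.train X i ω), euSource X ω)) μ := by
  have hm : ∀ i, Measurable (P.train X i) := fun i => (hX.isWhite_train i).1
  refine indepFun_prodMk_assoc (by fun_prop) (by fun_prop) hX.measurable_euSource
    (hX.iIndepFun_train.indepFun_finset S T hST hm) ?_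
  have hφ : Measurable fun z : TrainIdx M K J → CVec L =>
      ((fun (i : S) => z i), fun (i : T) => z i) := by fun_prop
  exact hX.indepFun_train_euSource.comp hφ measurable_id

/-- The estimation error of an AP for an information user is independent of all its other training
variables, of those of the other APs, and of all sources of the channels of the energy users. -/
lemma Network.IsRayleigh.indepFun_train_update (hX : P.IsRayleigh μ X) (i : TrainIdx M K J) :
    IndepFun (P.train X i)
      (fun ω => (Function.update (fun i => P.train X i ω) i 0, euSource X ω)) μ := by
  have h := hX.indepFun_train_finset (S := {i}) (T := Finset.univ.erase i) (by simp)
  have hφ : Measurable fun z : ({i} : Finset (TrainIdx M K J)) → CVec L => z ⟨i, by simp⟩ :=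
    measurable_pi_apply _
  have hψ : Measurable fun p : (↥(Finset.univ.erase i : Finset (TrainIdx M K J)) → CVec L) ×
      EuSpace M J L N => ((fun j => if hj : j = i then (0 : CVec L) else p.1 ⟨j, by simp [hj]⟩),
        p.2) := by
    refine Measurable.prodMk (measurable_pi_iff.mpr fun j => ?_) measurable_snd
    by_cases hj : j = i
    · simp [hj]
    · simp only [hj, dite_false]; fun_prop
  have h2 := h.comp hφ hψ
  convert h2 using 1
  · rfl
  funext ω
  refine Prod.ext ?_ rfl
  funext j
  by_cases hj : j = i
  · subst hj; simp
  · simp [hj]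

lemma Network.IsRayleigh.measurable_observation (hX : P.IsRayleigh μ X) (m : Fin M)
    (u : Fin K ⊕ Fin J) : Measurable (P.observation X m u) := by
  have hm : ∀ i, Measurable (P.train X i) := fun i => (hX.isWhite_train i).1
  cases u with
  | inl k => rw [funext (P.observation_inl X m k)]; exact hm _
  | inr j =>
    have h1 : Measurable (P.chanE X m j) := by
      have hcc := (P.continuous_cascade m j).measurable
      have hE : Measurable fun r : EuSpace M J L N => r.1 m j + P.cascade m j r.2 := by fun_prop
      exact hE.comp hX.measurable_euSource
    rw [funext (P.observation_inr X m j)]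
    have := hm (m, .inr j, false)
    fun_prop

lemma Network.IsRayleigh.memLp_observation (hX : P.IsRayleigh μ X) (m : Fin M)
    (u : Fin K ⊕ Fin J) : MemLp (P.observation X m u) 2 μ := by
  have hm : ∀ i, MemLp (P.train X i) 2 μ := fun i =>
    (hX.isWhite_train i).memLp (P.trainVar_nonneg i)
  cases u with
  | inl k => rw [funext (P.observation_inl X m k)]; exact hm _
  | inr j =>
    rw [funext (P.observation_inr X m j)]
    exact ((hX.memLp_chanE m j).const_smul (P.amp : ℂ)).add (hm _)

/-- The channel of an energy user is positively correlated with its observation. -/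
lemma Network.IsRayleigh.integral_inner_chanE_observation_ne_zero (hX : P.IsRayleigh μ X)
    (hL : 0 < L) (hτ : 0 < τ) (m : Fin M) (j : Fin J) :
    ∫ ω, (inner ℂ (P.chanE X m j ω) (P.observation X m (.inr j) ω)).re ∂μ ≠ 0 := by
  have hcc := (P.continuous_cascade m j).measurable
  have hi := hX.isWhite_train (m, .inr j, false)
  have h1 : ∫ ω, inner ℂ (P.chanE X m j ω) (P.train X (m, .inr j, false) ω) ∂μ = 0 := by
    have hφ : Measurable fun z : TrainIdx M K J → CVec L => z (m, .inr j, false) :=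
      measurable_pi_apply _
    refine IsCN.integral_odd_eq_zero hi hX.measurable_euSource
      (hX.indepFun_train_euSource.comp hφ measurable_id)
      (F := fun x r => inner ℂ (r.1 m j + P.cascade m j r.2) x)
      (by unfold Function.uncurry; fun_prop) (fun x y => inner_neg_right _ _)
  have i1 := integrable_inner (hX.memLp_chanE m j) (hi.memLp (P.trainVar_nonneg _))
  have h2 : ∫ ω, (inner ℂ (P.chanE X m j ω) (P.train X (m, .inr j, false) ω)).re ∂μ = 0 := by
    have := integral_re i1
    rw [h1] at this
    simpa using this
  have h3 : ∀ ω, (inner ℂ (P.chanE X m j ω) (P.observation X m (.inr j) ω)).re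
      = P.amp * ‖P.chanE X m j ω‖ ^ 2
        + (inner ℂ (P.chanE X m j ω) (P.train X (m, .inr j, false) ω)).re := by
    intro ω
    rw [P.observation_inr, inner_add_right, inner_smul_right, Complex.add_re,
      Complex.re_ofReal_mul, norm_sq_eq_re_inner (𝕜 := ℂ)]
    rfl
  have i2 := ((hX.memLp_chanE m j).integrable_norm_pow (p := 2) (by norm_num)).const_mul P.amp
  simp only [h3]
  have i3 : Integrable
    (fun ω => (inner ℂ (P.chanE X m j ω) (P.train X (m, .inr j, false) ω)).re) μ := i1.re
  rw [integral_add i2 i3, integral_const_mul, h2, add_zero]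
  have h4 : 0 < P.amp := Real.sqrt_pos.mpr (mul_pos (by exact_mod_cast hτ) P.rhoU_pos)
  exact (mul_pos h4 (hX.integral_norm_chanE_sq_pos hL m j)).ne'

end Rayleigh
end Training

/-! ### Downlink gains and the SINR -/

section Downlink

variable {M K J L N τ : ℕ} {Ω : Type*} [MeasurableSpace Ω] {μ : Measure Ω}

lemma IsWhite.const_smul {n : ℕ} {X : Ω → CVec n} {c : ℝ} (hX : IsWhite μ X c) (a : ℝ) :
    IsWhite μ (fun ω => (a : ℂ) • X ω) (a ^ 2 * c) := by
  obtain ⟨hm, h⟩ := isWhite_iff.mp hX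
  refine isWhite_iff.mpr ⟨by fun_prop, fun t => ?_⟩
  have := h ((a : ℂ) • t)
  simp only [inner_smul_left, Complex.conj_ofReal, norm_smul, Complex.norm_real] at this
  simp only [inner_smul_right]
  rw [this, mul_pow, Real.norm_eq_abs, sq_abs]
  congr 3
  ring

/-- Everything that the APs' estimates depend on: the training variables other than the estimation
errors, and the channels of the energy users. -/
noncomputable def Network.estData (P : Network M K J L N τ) (X : Fading M K J L N τ Ω) (ω : Ω) :
    (Fin M × (Fin K ⊕ Fin J) → CVec L) × EuSpace M J L N :=
  (fun i => P.train X (i.1, i.2, false) ω, euSource X ω)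

/-- `w` is a measurable function of the data of the estimates. -/
def Network.OfEstData (P : Network M K J L N τ) (X : Fading M K J L N τ Ω) (w : Ω → CVec L) :
    Prop :=
  ∃ φ : (Fin M × (Fin K ⊕ Fin J) → CVec L) × EuSpace M J L N → CVec L,
    Measurable φ ∧ ∀ ω, w ω = φ (P.estData X ω)

variable {P : Network M K J L N τ} {X : Fading M K J L N τ Ω}

omit [MeasurableSpace Ω] in
lemma Network.ofEstData_observation (m : Fin M) (u : Fin K ⊕ Fin J) :
    P.OfEstData X (P.observation X m u) := by
  cases u with
  | inl k => exact ⟨fun p => p.1 (m, .inl k), by fun_prop, P.observation_inl X m k⟩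
  | inr j =>
    have hcc := (P.continuous_cascade m j).measurable
    exact ⟨fun p => (P.amp : ℂ) • (p.2.1 m j + P.cascade m j p.2.2) + p.1 (m, .inr j),
      by fun_prop, P.observation_inr X m j⟩

omit [MeasurableSpace Ω] in
lemma Network.OfEstData.comp {w : Ω → CVec L} (hw : P.OfEstData X w) {f : CVec L → CVec L}
    (hf : Measurable f) : P.OfEstData X (fun ω => f (w ω)) := by
  obtain ⟨φ, hφ, h⟩ := hw
  exact ⟨fun p => f (φ p), hf.comp hφ, fun ω => congrArg f (h ω)⟩

lemma Network.OfEstData.precoderI {gI : Fin K → Ω → CVec L} (hg : ∀ k, P.OfEstData X (gI k))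
    (k : Fin K) : P.OfEstData X (precoderI μ gI k) := by
  choose φ hφ h using hg
  refine ⟨fun p => ((normFactor μ (zfDir gI k) : ℝ) : ℂ) • zfDir φ k p, ?_, fun ω => ?_⟩
  · exact (measurable_zfDir hφ k).const_smul ((normFactor μ (zfDir gI k) : ℝ) : ℂ)
  · have : colMatrix gI ω = colMatrix φ (P.estData X ω) := by
      ext l i
      simp only [colMatrix, Matrix.of_apply, h]
    simp only [CellFree.precoderI, zfDir, this]

lemma Network.OfEstData.precoderE {gI : Fin K → Ω → CVec L} {gE : Fin J → Ω → CVec L}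
    (hg : ∀ k, P.OfEstData X (gI k)) (hE : ∀ j, P.OfEstData X (gE j)) (j : Fin J) :
    P.OfEstData X (precoderE μ gI gE j) := by
  choose φ hφ h using hg
  choose ψ hψ h' using hE
  refine ⟨fun p => ((normFactor μ (pmrtDir gI gE j) : ℝ) : ℂ) • pmrtDir φ ψ j p, ?_,
    fun ω => ?_⟩
  · exact (measurable_pmrtDir hφ hψ j).const_smul ((normFactor μ (pmrtDir gI gE j) : ℝ) : ℂ)
  · have h1 : colMatrix gI ω = colMatrix φ (P.estData X ω) := by
      ext l i
      simp only [colMatrix, Matrix.of_apply, h]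
    have h2 : colMatrix gE ω = colMatrix ψ (P.estData X ω) := by
      ext l i
      simp only [colMatrix, Matrix.of_apply, h']
    simp only [CellFree.precoderE, pmrtDir, nullProj, h1, h2]

lemma Network.pilot_length_pos (P : Network M K J L N τ) (k : Fin K) : 0 < τ := by
  rcases Nat.eq_zero_or_pos τ with rfl | h
  · have := P.pilot_orthonormal.1 (.inl k)
    rw [Subsingleton.elim (P.pilot (.inl k)) 0, norm_zero] at this
    exact absurd this zero_ne_one
  · exact h

lemma Network.gammaI_pos (P : Network M K J L N τ) (m : Fin M) (k : Fin K) :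
    0 < P.gammaI m k := by
  have h1 : (0 : ℝ) < τ := by exact_mod_cast P.pilot_length_pos k
  have h2 := P.rhoU_pos
  have h3 := P.betaI_pos m k
  unfold gammaI
  positivity

variable [IsProbabilityMeasure μ]

lemma Network.IsRayleigh.measurable_estData (hX : P.IsRayleigh μ X) :
    Measurable (P.estData X) :=
  Measurable.prodMk (measurable_pi_iff.mpr fun _ => (hX.isWhite_train _).1)
    hX.measurable_euSource

lemma Network.OfEstData.measurable {w : Ω → CVec L} (hw : P.OfEstData X w)
    (hX : P.IsRayleigh μ X) : Measurable w := by
  obtain ⟨φ, hφ, h⟩ := hw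
  rw [funext h]
  exact hφ.comp hX.measurable_estData

/-- The estimation error of an AP for an information user is independent of the precoders of all APs
and of the estimation errors of the other APs. -/
lemma Network.IsRayleigh.indepFun_error (hX : P.IsRayleigh μ X) {w : Fin M → Ω → CVec L}
    (hw : ∀ i, P.OfEstData X (w i)) (k : Fin K) (m : Fin M) :
    IndepFun (P.train X (m, .inl k, true)) (fun ω => ((fun i => w i ω),
      Function.update (fun i => P.train X (i, .inl k, true) ω) m 0)) μ := by
  choose φ hφ h using hw
  have hψ : Measurable fun p : (TrainIdx M K J → CVec L) × EuSpace M J L N =>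
      ((fun i => φ i (fun s => p.1 (s.1, s.2, false), p.2)),
        fun i : Fin M => p.1 (i, .inl k, true)) := by
    fun_prop
  have h2 := (hX.indepFun_train_update (m, .inl k, true)).comp measurable_id hψ
  convert h2 using 1
  · rfl
  funext ω
  refine Prod.ext ?_ ?_ <;> funext i
  · simp [h, estData]
  · by_cases hi : i = m
    · subst hi; simp
    · have : ((i, .inl k, true) : TrainIdx M K J) ≠ (m, .inl k, true) := fun h => hi (by simpa using h)
      simp [Function.update_of_ne this, Function.update_of_ne hi]

/-- Second moment of the interference which the estimation errors of an information user cause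
through precoders that depend on the estimates only. -/
lemma Network.IsRayleigh.error_interference (hX : P.IsRayleigh μ X) {w : Fin M → Ω → CVec L}
    (hw : ∀ i, P.OfEstData X (w i)) (hw2 : ∀ i, MemLp (w i) 2 μ)
    (hw1 : ∀ i, ∫ ω, ‖w i ω‖ ^ 2 ∂μ = 1) (k : Fin K) (s : Fin M → ℝ) :
    MemLp (fun ω => ∑ m, (s m : ℂ) * inner ℂ (P.train X (m, .inl k, true) ω) (w m ω)) 2 μ ∧
      ∫ ω, ‖∑ m, (s m : ℂ) * inner ℂ (P.train X (m, .inl k, true) ω) (w m ω)‖ ^ 2 ∂μ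
        = ∑ m, s m ^ 2 * (P.betaI m k - P.gammaI m k) := by
  have h := memLp_integral_norm_sum_inner_sq (fun m => P.trainVar_nonneg (m, .inl k, true))
    (fun m => hX.isWhite_train (m, .inl k, true)) (fun m => (hw m).measurable hX) hw2
    (hX.indepFun_error hw k) s
  simpa only [hw1, mul_one, P.trainVar_error] using h

lemma Network.IsRayleigh.integral_error_inner (hX : P.IsRayleigh μ X) {w : Ω → CVec L}
    (hw : P.OfEstData X w) (hw2 : MemLp w 2 μ) (m : Fin M) (k : Fin K) :
    Integrable (fun ω => (inner ℂ (P.train X (m, .inl k, true) ω) (w ω) : ℂ)) μ ∧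
      ∫ ω, (inner ℂ (P.train X (m, .inl k, true) ω) (w ω) : ℂ) ∂μ = 0 := by
  have he := hX.isWhite_train (m, .inl k, true)
  refine ⟨integrable_inner (he.memLp (P.trainVar_nonneg _)) hw2, ?_⟩
  have hind : IndepFun (P.train X (m, .inl k, true)) w μ :=
    (hX.indepFun_error (w := fun _ => w) (fun _ => hw) k m).comp measurable_id
      ((measurable_pi_apply m).comp measurable_fst)
  exact IsCN.integral_odd_eq_zero he (hw.measurable hX) hind (F := fun x y => inner ℂ x y)
    (by unfold Function.uncurry; fun_prop) (fun x y => inner_neg_left x y)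

section Estimates

variable {gI : Fin M → Fin K → Ω → CVec L} {gE : Fin M → Fin J → Ω → CVec L}

/-- The MMSE estimate of a channel with white Gaussian law is the linear one. -/
lemma Network.IsRayleigh.ae_eq_of_isMMSE (hX : P.IsRayleigh μ X) {m : Fin M} {k : Fin K}
    {g : Ω → CVec L} (hg : IsMMSE μ (chanI X m k) (P.observation X m (.inl k)) g) :
    g =ᵐ[μ] fun ω => (P.wiener m (.inl k) : ℂ) • P.observation X m (.inl k) ω := by
  refine hg.ae_eq (P.trainVar_nonneg (m, .inl k, true)) (hX.isWhite_train (m, .inl k, true))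
    (hX.measurable_observation m _) (hX.memLp_observation m _) (P.chanI_eq X m k) ?_
  rw [funext (P.observation_inl X m k)]
  exact hX.iIndepFun_train.indepFun (by simp)

lemma Network.IsRayleigh.isWhite_of_isMMSE (hX : P.IsRayleigh μ X) {m : Fin M} {k : Fin K}
    {g : Ω → CVec L} (hg : IsMMSE μ (chanI X m k) (P.observation X m (.inl k)) g) :
    IsWhite μ g (P.gammaI m k) := by
  obtain ⟨f, hf, hgf, -⟩ := IsOptimalEstimate.exists_measurable hg
  have h1 := (hX.isWhite_train (m, .inl k, false)).const_smul (P.wiener m (.inl k))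
  rw [P.wiener_sq_mul_trainVar] at h1
  refine IsCN.congr h1 ?_ ?_
  · rw [funext hgf]
    exact hf.comp (hX.measurable_observation m _)
  · have h2 := hX.ae_eq_of_isMMSE hg
    simp only [P.observation_inl] at h2
    exact h2.symm

omit [IsProbabilityMeasure μ] in
lemma Network.ofEstData_of_isOptimalEstimate {F : Set (CVec L → CVec L)} {m : Fin M}
    {u : Fin K ⊕ Fin J} {c g : Ω → CVec L}
    (hg : IsOptimalEstimate μ F c (P.observation X m u) g) : P.OfEstData X g := by
  obtain ⟨f, hf, hgf, -⟩ := hg.exists_measurable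
  rw [funext hgf]
  exact (Network.ofEstData_observation m u).comp hf

lemma Network.IsRayleigh.iIndepFun_of_isMMSE (hX : P.IsRayleigh μ X) {m : Fin M}
    (hgI : ∀ k, IsMMSE μ (chanI X m k) (P.observation X m (.inl k)) (gI m k)) :
    iIndepFun (gI m) μ := by
  choose f hf hgf _ using fun k => IsOptimalEstimate.exists_measurable (hgI k)
  have hinj : Function.Injective fun k : Fin K => ((m, .inl k, false) : TrainIdx M K J) := by
    intro k k' h
    simpa using h
  convert (hX.iIndepFun_train.precomp hinj).comp f hf using 1
  funext k ω
  rw [hgf, P.observation_inl]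
  rfl

lemma Network.IsRayleigh.indepFun_of_isOptimalEstimate (hX : P.IsRayleigh μ X) {m : Fin M}
    (hgI : ∀ k, IsMMSE μ (chanI X m k) (P.observation X m (.inl k)) (gI m k)) {j : Fin J}
    {F : Set (CVec L → CVec L)} {c g : Ω → CVec L}
    (hg : IsOptimalEstimate μ F c (P.observation X m (.inr j)) g) :
    IndepFun (fun ω k => gI m k ω) g μ := by
  choose f hf hgf _ using fun k => IsOptimalEstimate.exists_measurable (hgI k)
  obtain ⟨f', hf', hgf', -⟩ := hg.exists_measurable
  set S : Finset (TrainIdx M K J) := Finset.univ.image fun k => (m, .inl k, false) with hS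
  set T : Finset (TrainIdx M K J) := {(m, .inr j, false)} with hT
  have hST : Disjoint S T := by simp [hS, hT]
  have hcc := (P.continuous_cascade m j).measurable
  have hφ : Measurable fun (z : S → CVec L) (k : Fin K) =>
      f k (z ⟨(m, .inl k, false), by simp [hS]⟩) := by fun_prop
  have hψ : Measurable fun p : (T → CVec L) × EuSpace M J L N =>
      f' ((P.amp : ℂ) • (p.2.1 m j + P.cascade m j p.2.2)
        + p.1 ⟨(m, .inr j, false), by simp [hT]⟩) := by fun_prop
  convert (hX.indepFun_train_finset hST).comp hφ hψ using 1
  · funext ω k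
    rw [hgf, P.observation_inl]
    rfl
  · funext ω
    rw [hgf', P.observation_inr]
    rfl

lemma Network.IsRayleigh.precoderI_properties (hX : P.IsRayleigh μ X) (hKL : K < L) {m : Fin M}
    (hgI : ∀ k, IsMMSE μ (chanI X m k) (P.observation X m (.inl k)) (gI m k)) (k : Fin K) :
    MemLp (precoderI μ (gI m) k) 2 μ ∧ ∫ ω, ‖precoderI μ (gI m) k ω‖ ^ 2 ∂μ = 1 :=
  precoderI_unit_power hKL (hX.iIndepFun_of_isMMSE hgI) (fun k => P.gammaI_pos m k)
    (fun k => hX.isWhite_of_isMMSE (hgI k)) k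

lemma Network.IsRayleigh.precoderE_properties (hX : P.IsRayleigh μ X) (hKL : K < L) (hτ : 0 < τ)
    {m : Fin M}
    (hgI : ∀ k, IsMMSE μ (chanI X m k) (P.observation X m (.inl k)) (gI m k))
    (hgE : ∀ j, IsMMSE μ (P.chanE X m j) (P.observation X m (.inr j)) (gE m j) ∨
      IsLinearMMSE μ (P.chanE X m j) (P.observation X m (.inr j)) (gE m j)) (j : Fin J) :
    MemLp (precoderE μ (gI m) (gE m) j) 2 μ ∧
      ∫ ω, ‖precoderE μ (gI m) (gE m) j ω‖ ^ 2 ∂μ = 1 := by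
  have hopt : ∀ j, ∃ F : Set (CVec L → CVec L), (∀ t : ℝ, (fun x => (t : ℂ) • x) ∈ F) ∧
      IsOptimalEstimate μ F (P.chanE X m j) (P.observation X m (.inr j)) (gE m j) := by
    intro j
    rcases hgE j with h | h
    · exact ⟨Set.univ, fun t => trivial, h⟩
    · exact ⟨Set.range fun A : CVec L →ₗ[ℂ] CVec L => (A : CVec L → CVec L),
        fun t => ⟨(t : ℂ) • LinearMap.id, rfl⟩, h⟩
  choose F hF hE using hopt
  have hm : ∀ j, Measurable (gE m j) := fun j =>
    (Network.ofEstData_of_isOptimalEstimate (hE j)).measurable hX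
  obtain ⟨-, -, -, hE2⟩ := (hE j).exists_measurable
  exact precoderE_unit_power hKL (hX.iIndepFun_of_isMMSE hgI) (fun k => P.gammaI_pos m k)
    (fun k => hX.isWhite_of_isMMSE (hgI k)) hm j (hX.indepFun_of_isOptimalEstimate hgI (hE j)) hE2
    ((hE j).not_ae_eq_zero (hF j) (hX.memLp_chanE m j) (hX.memLp_observation m _)
      (hX.integral_inner_chanE_observation_ne_zero (by omega) hτ m j))

lemma Network.IsRayleigh.ae_linearIndependent_of_isMMSE (hX : P.IsRayleigh μ X) (hKL : K < L)
    {m : Fin M} (hgI : ∀ k, IsMMSE μ (chanI X m k) (P.observation X m (.inl k)) (gI m k)) :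
    ∀ᵐ ω ∂μ, LinearIndependent ℂ fun k => gI m k ω :=
  ae_linearIndependent_of_iIndepFun hKL (hX.iIndepFun_of_isMMSE hgI) (fun k => P.gammaI_pos m k)
    (fun k => hX.isWhite_of_isMMSE (hgI k))

/-- The gain of a precoder splits into the gain seen by the AP, computed with the estimate, and the
contribution of the estimation error. -/
lemma Network.IsRayleigh.gain_ae_eq (hX : P.IsRayleigh μ X) {m : Fin M} {k : Fin K}
    {g : Ω → CVec L} (hg : IsMMSE μ (chanI X m k) (P.observation X m (.inl k)) g)
    (w : Ω → CVec L) : gain X m k w =ᵐ[μ] fun ω =>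
      inner ℂ (P.train X (m, .inl k, true) ω) (w ω) + inner ℂ (g ω) (w ω) := by
  filter_upwards [hX.ae_eq_of_isMMSE hg] with ω hω
  rw [gain, P.chanI_eq, inner_add_left, ← hω]

lemma Network.IsRayleigh.gain_precoderI_ae_eq (hX : P.IsRayleigh μ X) (hKL : K < L) {m : Fin M}
    (hgI : ∀ k, IsMMSE μ (chanI X m k) (P.observation X m (.inl k)) (gI m k)) (k k' : Fin K) :
    gain X m k (precoderI μ (gI m) k') =ᵐ[μ] fun ω =>
      inner ℂ (P.train X (m, .inl k, true) ω) (precoderI μ (gI m) k' ω)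
        + if k = k' then ((√(P.gammaI m k * (L - K : ℝ)) : ℝ) : ℂ) else 0 := by
  filter_upwards [hX.gain_ae_eq (hgI k) (precoderI μ (gI m) k'),
    hX.ae_linearIndependent_of_isMMSE hKL hgI] with ω h1 h2
  rw [h1]
  congr 1
  rw [precoderI, inner_smul_right, inner_zfDir h2,
    normFactor_zfDir hKL (hX.iIndepFun_of_isMMSE hgI) (fun k => P.gammaI_pos m k)
      (fun k => hX.isWhite_of_isMMSE (hgI k))]
  by_cases h : k = k'
  · simp [h]
  · simp [h]

lemma Network.IsRayleigh.gain_precoderE_ae_eq (hX : P.IsRayleigh μ X) (hKL : K < L) {m : Fin M}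
    (hgI : ∀ k, IsMMSE μ (chanI X m k) (P.observation X m (.inl k)) (gI m k))
    (gE : Fin J → Ω → CVec L) (k : Fin K) (j : Fin J) :
    gain X m k (precoderE μ (gI m) gE j) =ᵐ[μ] fun ω =>
      inner ℂ (P.train X (m, .inl k, true) ω) (precoderE μ (gI m) gE j ω) := by
  filter_upwards [hX.gain_ae_eq (hgI k) (precoderE μ (gI m) gE j),
    hX.ae_linearIndependent_of_isMMSE hKL hgI] with ω h1 h2
  rw [h1, precoderE, inner_smul_right (gI m k ω), inner_pmrtDir h2, mul_zero, add_zero]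

lemma Network.IsRayleigh.integral_gain_precoderI (hX : P.IsRayleigh μ X) (hKL : K < L)
    {m : Fin M}
    (hgI : ∀ k, IsMMSE μ (chanI X m k) (P.observation X m (.inl k)) (gI m k)) (k : Fin K) :
    Integrable (gain X m k (precoderI μ (gI m) k)) μ ∧
      ∫ ω, gain X m k (precoderI μ (gI m) k) ω ∂μ
        = ((√(P.gammaI m k * (L - K : ℝ)) : ℝ) : ℂ) := by
  have h := hX.gain_precoderI_ae_eq hKL hgI k k
  simp only [if_true] at h
  obtain ⟨h1, h2⟩ := hX.integral_error_inner (Network.OfEstData.precoderI (μ := μ)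
    (fun k => Network.ofEstData_of_isOptimalEstimate (hgI k)) k)
    (hX.precoderI_properties hKL hgI k).1 m k
  refine ⟨(h1.add (integrable_const _)).congr h.symm, ?_⟩
  rw [integral_congr_ae h, integral_add h1 (integrable_const _), h2]
  simp

variable (Q : Control M K J)

lemma Network.sqrt_infoPower_sq (P : Network M K J L N τ) (m : Fin M) (k : Fin K) :
    √(Q.a m * P.rhoD * Q.etaI m k) ^ 2 = P.rhoD * (Q.a m * Q.etaI m k) := by
  have h1 : 0 ≤ Q.a m := by rcases Q.a_mode m with h | h <;> simp [h]
  rw [Real.sq_sqrt (mul_nonneg (mul_nonneg h1 P.rhoD_pos.le) (Q.etaI_nonneg m k))]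
  ring

lemma Network.sqrt_energyPower_sq (P : Network M K J L N τ) (m : Fin M) (j : Fin J) :
    √((1 - Q.a m) * P.rhoD * Q.etaE m j) ^ 2 = P.rhoD * ((1 - Q.a m) * Q.etaE m j) := by
  have h1 : 0 ≤ 1 - Q.a m := by rcases Q.a_mode m with h | h <;> simp [h]
  rw [Real.sq_sqrt (mul_nonneg (mul_nonneg h1 P.rhoD_pos.le) (Q.etaE_nonneg m j))]
  ring

lemma Network.IsRayleigh.norm_DS_sq (hX : P.IsRayleigh μ X) (hKL : K < L)
    (hgI : ∀ m k, IsMMSE μ (chanI X m k) (P.observation X m (.inl k)) (gI m k)) (k : Fin K) :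
    ‖P.DS Q μ X gI k‖ ^ 2
      = P.rhoD * ((L - K : ℝ) * (∑ m, √(Q.a m * Q.etaI m k * P.gammaI m k)) ^ 2) := by
  have hLK : (0 : ℝ) ≤ L - K := sub_nonneg.mpr (by exact_mod_cast hKL.le)
  have hρ := P.rhoD_pos
  have h1 : P.DS Q μ X gI k = ((√(P.rhoD * (L - K : ℝ)) *
      ∑ m, √(Q.a m * Q.etaI m k * P.gammaI m k) : ℝ) : ℂ) := by
    rw [DS, Finset.mul_sum, Complex.ofReal_sum]
    refine Finset.sum_congr rfl fun m _ => ?_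
    rw [(hX.integral_gain_precoderI hKL (hgI m) k).2, ← Complex.ofReal_mul]
    congr 1
    have ha : 0 ≤ Q.a m := by rcases Q.a_mode m with h | h <;> simp [h]
    rw [← Real.sqrt_mul (mul_nonneg (mul_nonneg ha hρ.le) (Q.etaI_nonneg m k)),
      ← Real.sqrt_mul (mul_nonneg hρ.le hLK)]
    congr 1
    ring
  rw [h1, Complex.norm_real, Real.norm_eq_abs, sq_abs, mul_pow,
    Real.sq_sqrt (mul_nonneg hρ.le hLK)]
  ring

lemma Network.IsRayleigh.BU_properties (hX : P.IsRayleigh μ X) (hKL : K < L)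
    (hgI : ∀ m k, IsMMSE μ (chanI X m k) (P.observation X m (.inl k)) (gI m k)) (k : Fin K) :
    MemLp (P.BU Q μ X gI k) 2 μ ∧ ∫ ω, ‖P.BU Q μ X gI k ω‖ ^ 2 ∂μ
      = P.rhoD * ∑ m, Q.a m * Q.etaI m k * (P.betaI m k - P.gammaI m k) := by
  obtain ⟨h1, h2⟩ := hX.error_interference (w := fun m => precoderI μ (gI m) k)
    (fun m => .precoderI (fun k => Network.ofEstData_of_isOptimalEstimate (hgI m k)) k)
    (fun m => (hX.precoderI_properties hKL (hgI m) k).1)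
    (fun m => (hX.precoderI_properties hKL (hgI m) k).2) k
    (fun m => √(Q.a m * P.rhoD * Q.etaI m k))
  have h3 : P.BU Q μ X gI k =ᵐ[μ] fun ω => ∑ m, ((√(Q.a m * P.rhoD * Q.etaI m k) : ℝ) : ℂ) *
      inner ℂ (P.train X (m, .inl k, true) ω) (precoderI μ (gI m) k ω) := by
    filter_upwards [ae_all_iff.mpr fun m => hX.gain_precoderI_ae_eq hKL (hgI m) k k] with ω hω
    refine Finset.sum_congr rfl fun m _ => ?_
    rw [hω m, (hX.integral_gain_precoderI hKL (hgI m) k).2, if_pos rfl, add_sub_cancel_right]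
  refine ⟨(memLp_congr_ae h3).mpr h1, ?_⟩
  rw [integral_congr_ae (h3.mono fun ω hω => by rw [hω]), h2, Finset.mul_sum]
  exact Finset.sum_congr rfl fun m _ => by rw [P.sqrt_infoPower_sq]; ring

lemma Network.IsRayleigh.IUI_properties (hX : P.IsRayleigh μ X) (hKL : K < L)
    (hgI : ∀ m k, IsMMSE μ (chanI X m k) (P.observation X m (.inl k)) (gI m k)) (k k' : Fin K) :
    MemLp (P.IUI Q μ X gI k k') 2 μ ∧ (k ≠ k' → ∫ ω, ‖P.IUI Q μ X gI k k' ω‖ ^ 2 ∂μ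
      = P.rhoD * ∑ m, Q.a m * Q.etaI m k' * (P.betaI m k - P.gammaI m k)) := by
  obtain ⟨h1, h2⟩ := hX.error_interference (w := fun m => precoderI μ (gI m) k')
    (fun m => .precoderI (fun k => Network.ofEstData_of_isOptimalEstimate (hgI m k)) k')
    (fun m => (hX.precoderI_properties hKL (hgI m) k').1)
    (fun m => (hX.precoderI_properties hKL (hgI m) k').2) k
    (fun m => √(Q.a m * P.rhoD * Q.etaI m k'))
  have h3 : P.IUI Q μ X gI k k' =ᵐ[μ] fun ω => ∑ m, ((√(Q.a m * P.rhoD * Q.etaI m k') : ℝ) : ℂ) *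
      inner ℂ (P.train X (m, .inl k, true) ω) (precoderI μ (gI m) k' ω)
      + ∑ m, ((√(Q.a m * P.rhoD * Q.etaI m k') : ℝ) : ℂ) *
        if k = k' then ((√(P.gammaI m k * (L - K : ℝ)) : ℝ) : ℂ) else 0 := by
    filter_upwards [ae_all_iff.mpr fun m => hX.gain_precoderI_ae_eq hKL (hgI m) k k'] with ω hω
    rw [← Finset.sum_add_distrib]
    refine Finset.sum_congr rfl fun m _ => ?_
    rw [hω m, mul_add]
  refine ⟨(memLp_congr_ae h3).mpr (h1.add (memLp_const _)), fun hk => ?_⟩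
  simp only [if_neg hk, mul_zero, Finset.sum_const_zero, add_zero] at h3
  rw [integral_congr_ae (h3.mono fun ω hω => by rw [hω]), h2, Finset.mul_sum]
  exact Finset.sum_congr rfl fun m _ => by rw [P.sqrt_infoPower_sq]; ring

lemma Network.IsRayleigh.EUI_properties (hX : P.IsRayleigh μ X) (hKL : K < L)
    (hgI : ∀ m k, IsMMSE μ (chanI X m k) (P.observation X m (.inl k)) (gI m k))
    (hgE : ∀ m j, IsMMSE μ (P.chanE X m j) (P.observation X m (.inr j)) (gE m j) ∨
      IsLinearMMSE μ (P.chanE X m j) (P.observation X m (.inr j)) (gE m j))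
    (k : Fin K) (j : Fin J) :
    MemLp (P.EUI Q μ X gI gE k j) 2 μ ∧ ∫ ω, ‖P.EUI Q μ X gI gE k j ω‖ ^ 2 ∂μ
      = P.rhoD * ∑ m, (1 - Q.a m) * Q.etaE m j * (P.betaI m k - P.gammaI m k) := by
  have hτ := P.pilot_length_pos k
  obtain ⟨h1, h2⟩ := hX.error_interference (w := fun m => precoderE μ (gI m) (gE m) j)
    (fun m => .precoderE (fun k => Network.ofEstData_of_isOptimalEstimate (hgI m k))
      (fun j => (hgE m j).elim Network.ofEstData_of_isOptimalEstimate
        Network.ofEstData_of_isOptimalEstimate) j)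
    (fun m => (hX.precoderE_properties hKL hτ (hgI m) (hgE m) j).1)
    (fun m => (hX.precoderE_properties hKL hτ (hgI m) (hgE m) j).2) k
    (fun m => √((1 - Q.a m) * P.rhoD * Q.etaE m j))
  have h3 : P.EUI Q μ X gI gE k j =ᵐ[μ] fun ω =>
      ∑ m, ((√((1 - Q.a m) * P.rhoD * Q.etaE m j) : ℝ) : ℂ) *
        inner ℂ (P.train X (m, .inl k, true) ω) (precoderE μ (gI m) (gE m) j ω) := by
    filter_upwards [ae_all_iff.mpr fun m =>
      hX.gain_precoderE_ae_eq hKL (hgI m) (gE m) k j] with ω hω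
    exact Finset.sum_congr rfl fun m _ => by rw [hω m]
  refine ⟨(memLp_congr_ae h3).mpr h1, ?_⟩
  rw [integral_congr_ae (h3.mono fun ω hω => by rw [hω]), h2, Finset.mul_sum]
  exact Finset.sum_congr rfl fun m _ => by rw [P.sqrt_energyPower_sq]; ring

lemma Network.IsRayleigh.SINR_eq (hX : P.IsRayleigh μ X) (hKL : K < L)
    (hgI : ∀ m k, IsMMSE μ (chanI X m k) (P.observation X m (.inl k)) (gI m k))
    (hgE : ∀ m j, IsMMSE μ (P.chanE X m j) (P.observation X m (.inr j)) (gE m j) ∨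
      IsLinearMMSE μ (P.chanE X m j) (P.observation X m (.inr j)) (gE m j)) (k : Fin K) :
    P.SINR Q μ X gI gE k = P.closedSINR Q k := by
  have hρ := P.rhoD_pos
  have h1 : ∑ k' ∈ Finset.univ.erase k, ∫ ω, ‖P.IUI Q μ X gI k k' ω‖ ^ 2 ∂μ
      = ∑ k' ∈ Finset.univ.erase k,
        P.rhoD * ∑ m, Q.a m * Q.etaI m k' * (P.betaI m k - P.gammaI m k) :=
    Finset.sum_congr rfl fun k' hk' =>
      (hX.IUI_properties Q hKL hgI k k').2 (Finset.ne_of_mem_erase hk').symm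
  rw [SINR, closedSINR, hX.norm_DS_sq Q hKL hgI, (hX.BU_properties Q hKL hgI k).2, h1,
    Finset.add_sum_erase Finset.univ
      (fun k' => P.rhoD * ∑ m, Q.a m * Q.etaI m k' * (P.betaI m k - P.gammaI m k))
      (Finset.mem_univ k)]
  simp only [fun j => (hX.EUI_properties Q hKL hgI hgE k j).2, ← Finset.mul_sum]
  rw [← mul_div_mul_left _ (∑ k', _ + _ + 1 / P.rhoD) hρ.ne']
  congr 1
  field_simp

end Estimates
end Downlink

end CellFree

theorem proposition1 {M K J L N τ τc : ℕ} (hLK : K < L) (hτ : τ ≤ τc)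
    (P : CellFree.Network M K J L N τ) (Q : CellFree.Control M K J)
    {Ω : Type*} [MeasurableSpace Ω] (μ : MeasureTheory.Measure Ω)
    [MeasureTheory.IsProbabilityMeasure μ]
    (X : CellFree.Fading M K J L N τ Ω) (hX : P.IsRayleigh μ X)
    (gI : Fin M → Fin K → Ω → CellFree.CVec L) (gE : Fin M → Fin J → Ω → CellFree.CVec L)
    (hgI : ∀ m k, CellFree.IsMMSE μ (CellFree.chanI X m k) (P.observation X m (Sum.inl k)) (gI m k))
    (hgE : ∀ m j,
      CellFree.IsMMSE μ (P.chanE X m j) (P.observation X m (Sum.inr j)) (gE m j) ∨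
      CellFree.IsLinearMMSE μ (P.chanE X m j) (P.observation X m (Sum.inr j)) (gE m j))
    (k : Fin K) :
    -- the estimates have the stated variance, and the precoders are well defined with unit power
    (∀ m k' l, ∫ ω, ‖gI m k' ω l‖ ^ 2 ∂μ = P.gammaI m k') ∧
    (∀ m, ∀ᵐ ω ∂μ,
      IsUnit ((CellFree.colMatrix (gI m) ω)ᴴ * CellFree.colMatrix (gI m) ω)) ∧
    (∀ m k', ∫ ω, ‖CellFree.precoderI μ (gI m) k' ω‖ ^ 2 ∂μ = 1) ∧
    (∀ m j, ∫ ω, ‖CellFree.precoderE μ (gI m) (gE m) j ω‖ ^ 2 ∂μ = 1) ∧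
    -- every expectation in the SINR is finite
    (∀ m, MeasureTheory.Integrable
      (CellFree.gain X m k (CellFree.precoderI μ (gI m) k)) μ) ∧
    MeasureTheory.MemLp (P.BU Q μ X gI k) 2 μ ∧
    (∀ k', MeasureTheory.MemLp (P.IUI Q μ X gI k k') 2 μ) ∧
    (∀ j, MeasureTheory.MemLp (P.EUI Q μ X gI gE k j) 2 μ) ∧
    -- the closed form
    P.SINR Q μ X gI gE k = P.closedSINR Q k ∧
    P.SE Q τc μ X gI gE k = (1 - (τ : ℝ) / τc) * Real.logb 2 (1 + P.closedSINR Q k) := by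
  have hτ0 := P.pilot_length_pos k
  refine ⟨fun m k' l => ?_, fun m => ?_,
    fun m k' => (hX.precoderI_properties hLK (hgI m) k').2,
    fun m j => (hX.precoderE_properties hLK hτ0 (hgI m) (hgE m) j).2,
    fun m => (hX.integral_gain_precoderI hLK (hgI m) k).1,
    (hX.BU_properties Q hLK hgI k).1,
    fun k' => (hX.IUI_properties Q hLK hgI k k').1,
    fun j => (hX.EUI_properties Q hLK hgI hgE k j).1,
    hX.SINR_eq Q hLK hgI hgE k, ?_⟩
  · have h := (hX.isWhite_of_isMMSE (hgI m k')).integral_norm_inner_sq (P.gammaI_pos m k').le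
      (EuclideanSpace.single l 1)
    simpa [EuclideanSpace.inner_single_left] using h
  · filter_upwards [hX.ae_linearIndependent_of_isMMSE hLK (hgI m)] with ω hω
    exact CellFree.isUnit_gram hω
  · rw [CellFree.Network.SE, hX.SINR_eq Q hLK hgI hgE k]
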